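/- For integers $k,n\ge 1$ let $\tau_{1,k}(n)$ be the number of pairs $(a,b)$ of positive integers with $ab^k=n$. For $k\ge 2$ call a real number $\theta$ admissible if, for every $\varepsilon>0$, $$\sum_{n\le x}\tau_{1,k}(n)=\zeta(k)x+\zeta(1/k)x^{1/k}+O(x^{\theta+\varepsilon})\qquad(x\to\infty),$$ where $\zeta$ is the Riemann zeta function. Let $k,r\ge 2$ be integers. Then there is a least admissible $\theta$, denoted $\theta_k$, and for every $\varepsilon>0$, as $x\to\infty$, $$\sum_{n_1,\dots,n_r\le x}\tau_{1,k}(n_1\cdots n_r)=A_{r,k}x^r+B_{r,k}x^{r-1+1/k}+O(x^{r-1+\theta_k+\varepsilon}),$$ $$\sum_{n_1,\dots,n_r\le x}\tau_{1,k}([n_1,\dots,n_r])=C_{r,k}x^r+D_{r,k}x^{r-1+1/k}+O(x^{r-1+\theta_k+\varepsilon}),$$ where the sums run over positive integers, $[n_1,\dots,n_r]$ is the least common multiple, and the implied constants may depend on $r,k,\varepsilon$. (Hence the same holds with $\theta_k$ replaced by any admissible $\theta$.) The constants are $$A_{r,k}=\prod_p\Bigl(1-\frac1p\Bigr)^r\sum_{\nu_1,\dots,\nu_r=0}^{\infty}\frac{\lfloor(\nu_1+\cdots+\nu_r)/k\rfloor+1}{p^{\nu_1+\cdots+\nu_r}},\qquad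 C_{r,k}=\prod_p\Bigl(1-\frac1p\Bigr)^r\sum_{\nu_1,\dots,\nu_r=0}^{\infty}\frac{\lfloor\max(\nu_1,\dots,\nu_r)/k\rfloor+1}{p^{\nu_1+\cdots+\nu_r}},$$ $$B_{r,k}=r\,\zeta(k)^{r-1}\zeta(1/k)\,F_{r,k}(1,\dots,1,1/k),\qquad D_{r,k}=r\,\zeta(k)^{r-1}\zeta(1/k)\,G_{r,k}(1,\dots,1,1/k),$$ with $$F_{r,k}(s_1,\dots,s_r)=\prod_p\ \prod_{j=1}^r\Bigl(1-\frac1{p^{s_j}}\Bigr)\Bigl(1-\frac1{p^{ks_j}}\Bigr)\sum_{\nu_1,\dots,\nu_r=0}^{\infty}\frac{\lfloor(\nu_1+\cdots+\nu_r)/k\rfloor+1}{p^{\nu_1s_1+\cdots+\nu_rs_r}}$$ and $G_{r,k}$ given by the same formula with $\max(\nu_1,\dots,\nu_r)$ in place of $\nu_1+\cdots+\nu_r$. Products over $p$ are over all primes, and all these series and products converge unconditionally at the points in question. -/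

import Mathlib

open Filter Asymptotics

noncomputable section

namespace DivisorAverages

/-- `τ_{1,k}(n)`: the number of pairs `(a, b)` of positive integers with `a * b ^ k = n`
(for `k, n ≥ 1` both `a` and `b` divide `n`). -/
def tau (k n : ℕ) : ℕ :=
  ((n.divisors ×ˢ n.divisors).filter (fun ab => ab.1 * ab.2 ^ k = n)).card

/-- The value of the Riemann zeta function at a real point (which is a real number). -/
def zetaR (s : ℝ) : ℝ := (riemannZeta (s : ℂ)).re

/-- The error term `∑_{n ≤ x} τ_{1,k}(n) - (ζ(k) x + ζ(1/k) x^{1/k})`. -/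
def oneVarError (k : ℕ) (x : ℝ) : ℝ :=
  (∑ n ∈ Finset.Icc 1 ⌊x⌋₊, (tau k n : ℝ))
    - (zetaR k * x + zetaR (1 / (k : ℝ)) * x ^ (1 / (k : ℝ)))

/-- The exponents `θ` for which
`∑_{n ≤ x} τ_{1,k}(n) = ζ(k) x + ζ(1/k) x^{1/k} + O(x^{θ+ε})` for every `ε > 0`. -/
def admissibleExponents (k : ℕ) : Set ℝ :=
  {θ | ∀ ε : ℝ, 0 < ε → oneVarError k =O[atTop] fun x : ℝ => x ^ (θ + ε)}

/-- `θ_k`: the best exponent in the one-variable formula. -/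
def theta (k : ℕ) : ℝ := sInf (admissibleExponents k)

/-- The integer tuples `(n_1, …, n_r)` with `1 ≤ n_j ≤ x` for all `j`. -/
def box (r : ℕ) (x : ℝ) : Finset (Fin r → ℕ) :=
  Fintype.piFinset fun _ => Finset.Icc 1 ⌊x⌋₊

/-- `∑_{n_1, …, n_r ≤ x} τ_{1,k}(n_1 ⋯ n_r)`. -/
def prodSum (r k : ℕ) (x : ℝ) : ℝ := ∑ n ∈ box r x, (tau k (∏ j, n j) : ℝ)

/-- `∑_{n_1, …, n_r ≤ x} τ_{1,k}([n_1, …, n_r])`. -/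
def lcmSum (r k : ℕ) (x : ℝ) : ℝ := ∑ n ∈ box r x, (tau k (Finset.univ.lcm n) : ℝ)

/-- `⌊(ν_1 + ⋯ + ν_r) / k⌋ + 1`. -/
def prodWeight (r k : ℕ) (ν : Fin r → ℕ) : ℕ := (∑ j, ν j) / k + 1

/-- `⌊max(ν_1, …, ν_r) / k⌋ + 1`. -/
def lcmWeight (r k : ℕ) (ν : Fin r → ℕ) : ℕ := (Finset.univ.sup ν) / k + 1

/-- The terms `w(ν) / p ^ (ν_1 s_1 + ⋯ + ν_r s_r)` of the local series at `p`. -/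
def localTerm {r : ℕ} (w : (Fin r → ℕ) → ℕ) (s : Fin r → ℝ) (p : ℕ) (ν : Fin r → ℕ) : ℝ :=
  (w ν : ℝ) / (p : ℝ) ^ (∑ j, (ν j : ℝ) * s j)

/-- The local factor `(1 - 1/p)^r ∑_ν w(ν) / p ^ (ν_1 + ⋯ + ν_r)`. -/
def mainFactor {r : ℕ} (w : (Fin r → ℕ) → ℕ) (p : ℕ) : ℝ :=
  (1 - 1 / (p : ℝ)) ^ r * ∑' ν : Fin r → ℕ, (w ν : ℝ) / (p : ℝ) ^ (∑ j, ν j)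

/-- The local factor
`∏_j (1 - p ^ (-s_j)) (1 - p ^ (-k s_j)) * ∑_ν w(ν) / p ^ (ν_1 s_1 + ⋯ + ν_r s_r)`. -/
def secondFactor {r : ℕ} (k : ℕ) (w : (Fin r → ℕ) → ℕ) (s : Fin r → ℝ) (p : ℕ) : ℝ :=
  (∏ j, (1 - (p : ℝ) ^ (-s j)) * (1 - (p : ℝ) ^ (-((k : ℝ) * s j))))
    * ∑' ν : Fin r → ℕ, localTerm w s p ν

/-- The point `(1, …, 1, 1/k)` of `ℝ^r`. -/
def secondPoint (r k : ℕ) (j : Fin r) : ℝ := if (j : ℕ) + 1 = r then 1 / (k : ℝ) else 1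

/-- The coefficient of `x ^ r` attached to the weight `w`. -/
def mainConst {r : ℕ} (w : (Fin r → ℕ) → ℕ) : ℝ := ∏' p : Nat.Primes, mainFactor w p

/-- The coefficient of `x ^ (r - 1 + 1/k)` attached to the weight `w`. -/
def secondConst {r : ℕ} (k : ℕ) (w : (Fin r → ℕ) → ℕ) : ℝ :=
  (r : ℝ) * zetaR k ^ (r - 1) * zetaR (1 / (k : ℝ))
    * ∏' p : Nat.Primes, secondFactor k w (secondPoint r k) p

/-- All series and products defining `mainConst w` and `secondConst k w` converge absolutely
(unconditionally). -/
def ConstsConverge {r : ℕ} (k : ℕ) (w : (Fin r → ℕ) → ℕ) : Prop :=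
  (∀ p : Nat.Primes, Summable fun ν : Fin r → ℕ => (w ν : ℝ) / ((p : ℕ) : ℝ) ^ (∑ j, ν j)) ∧
  (Multipliable fun p : Nat.Primes => mainFactor w p) ∧
  (∀ p : Nat.Primes, Summable (localTerm w (secondPoint r k) p)) ∧
  (Multipliable fun p : Nat.Primes => secondFactor k w (secondPoint r k) p)

/-- `A_{r,k}`. -/
def constA (r k : ℕ) : ℝ := mainConst (prodWeight r k)

/-- `B_{r,k}`. -/
def constB (r k : ℕ) : ℝ := secondConst k (prodWeight r k)

/-- `C_{r,k}`. -/
def constC (r k : ℕ) : ℝ := mainConst (lcmWeight r k)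

/-- `D_{r,k}`. -/
def constD (r k : ℕ) : ℝ := secondConst k (lcmWeight r k)

end DivisorAverages

end

/-! Both summands are multiplicative functions of r variables whose local weight `w` at exponents
`ν` does not depend on the prime. Such a function is a Dirichlet convolution of a `corrector` h with
τ ⊗ ⋯ ⊗ τ, where τ = τ_{1,k}. The local series of h is ∏ (1 - X_j)(1 - X_j^k) · ∑ w(ν) X^ν.

On the coordinate axes `w` agrees with the weight of τ ⊗ ⋯ ⊗ τ, so h has no local term with exactly
one nonzero exponent (`localCoeff_axis`). Every nonconstant term then involves two exponents, and
the Dirichlet series of h converges absolutely wherever all s_j > 0 and s_i + s_j ≥ 1 + δ with δ > 0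
(`summable_corrector`). This region contains (1, …, 1) and (1, …, a, …, 1) for 0 < a ≤ 1.

Let T be the summatory function of τ. The sum over the box is ∑_d h(d) ∏ T(x / d_j). Write T(y) = y
(ζ(k) + ρ(y)) and expand the product (`abs_prod_tauSum_sub_le`). Order zero gives x^r. Order one
gives the terms x^(r-1+1/k) and the one-variable error. The products ρ_i ρ_j with i ≠ j are bounded
using |ρ(y)| ≪ y^(β-1) with 2β = 1 + θ, which costs exactly x^(r-1+θ) and still leaves a convergent
series in d. Euler products then identify the values of the series of h with the stated constants.
-/

namespace DivisorAverages

/-! ### Multiplicative functions of several variables and their Euler products. -/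

variable {ι : Type*} [Fintype ι]

/-- The vector of exponents of `p` in the entries of a tuple. -/
def expVec (n : ι → ℕ) (p : ℕ) : ι → ℕ := fun j => (n j).factorization p

/-- The multiplicative function of several variables with local values `u p ν` at
`(p ^ ν_j)_j`, extended by zero to tuples with a vanishing entry. -/
noncomputable def mulExt (u : ℕ → (ι → ℕ) → ℝ) (n : ι → ℕ) : ℝ :=
  if ∏ j, n j = 0 then 0 else ∏ p ∈ (∏ j, n j).primeFactors, u p (expVec n p)

theorem mulExt_of_eq_zero (u : ℕ → (ι → ℕ) → ℝ) {n : ι → ℕ} {j : ι} (h : n j = 0) :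
    mulExt u n = 0 := if_pos (Finset.prod_eq_zero (Finset.mem_univ j) h)

/-- Superfluous primes contribute factors `u p 0 = 1`. Several tuples can therefore be evaluated
over one common set of primes. -/
theorem mulExt_eq_prod {u : ℕ → (ι → ℕ) → ℝ} (hu : ∀ p, u p 0 = 1) {n : ι → ℕ}
    (hn : ∀ j, n j ≠ 0) {P : Finset ℕ} (hP : ∀ j, (n j).primeFactors ⊆ P) :
    mulExt u n = ∏ p ∈ P, u p (expVec n p) := by
  have h0 : ∏ j, n j ≠ 0 := Finset.prod_ne_zero_iff.mpr fun j _ => hn j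
  rw [mulExt, if_neg h0]
  apply Finset.prod_subset
  · intro p hp
    obtain ⟨hp, hd, -⟩ := Nat.mem_primeFactors.mp hp
    obtain ⟨j, -, hj⟩ := (Prime.dvd_finsetProd_iff hp.prime _).mp hd
    exact hP j (Nat.mem_primeFactors.mpr ⟨hp, hj, hn j⟩)
  · intro p _ hp
    have : expVec n p = 0 := by
      funext j
      by_contra hj
      have hj' : p ∈ (n j).primeFactors := Finsupp.mem_support_iff.mpr hj
      exact hp (Nat.primeFactors_mono (Finset.dvd_prod_of_mem n (Finset.mem_univ j)) h0 hj')
    rw [this, hu]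

theorem mulExt_one {u : ℕ → (ι → ℕ) → ℝ} (hu : ∀ p, u p 0 = 1) :
    mulExt u (fun _ : ι => 1) = 1 := by
  rw [mulExt_eq_prod hu (P := ∅) (by simp) (by simp), Finset.prod_empty]

theorem mulExt_pow_mul {u : ℕ → (ι → ℕ) → ℝ} (hu : ∀ p, u p 0 = 1) {p : ℕ} (hp : p.Prime)
    (ν m : ι → ℕ) (hm : ∀ j, m j ≠ 0) (hpm : ∀ j, ¬ p ∣ m j) :
    mulExt u (fun j => p ^ ν j * m j) = u p ν * mulExt u m := by
  classical
  set P := (∏ j, m j).primeFactors with hP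
  have h0 : ∏ j, m j ≠ 0 := Finset.prod_ne_zero_iff.mpr fun j _ => hm j
  have hmP : ∀ j, (m j).primeFactors ⊆ P := fun j =>
    Nat.primeFactors_mono (Finset.dvd_prod_of_mem m (Finset.mem_univ j)) h0
  have hpP : p ∉ P := fun h => by
    obtain ⟨j, -, hj⟩ :=
      (Prime.dvd_finsetProd_iff hp.prime _).mp (Nat.dvd_of_mem_primeFactors h)
    exact hpm j hj
  have hne : ∀ j, p ^ ν j * m j ≠ 0 := fun j => mul_ne_zero (pow_ne_zero _ hp.ne_zero) (hm j)
  rw [mulExt_eq_prod hu hm hmP, mulExt_eq_prod hu hne (P := insert p P),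
    Finset.prod_insert hpP]
  · congr 1
    · congr 1
      funext j
      simp [expVec, Nat.factorization_mul (pow_ne_zero (ν j) hp.ne_zero) (hm j),
        Nat.factorization_eq_zero_of_not_dvd (hpm j), hp.factorization_self]
    · refine Finset.prod_congr rfl fun q hq => ?_
      have hqp : p ≠ q := fun h => hpP (h ▸ hq)
      congr 1
      funext j
      simp [expVec, Nat.factorization_mul (pow_ne_zero (ν j) hp.ne_zero) (hm j),
        hp.factorization, hqp]
  · intro j q hq
    rw [Nat.primeFactors_mul (pow_ne_zero _ hp.ne_zero) (hm j), Finset.mem_union] at hq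
    rcases hq with hq | hq
    · have := (Nat.prime_dvd_prime_iff_eq (Nat.prime_of_mem_primeFactors hq) hp).mp
        ((Nat.prime_of_mem_primeFactors hq).dvd_of_dvd_pow (Nat.dvd_of_mem_primeFactors hq))
      exact this ▸ Finset.mem_insert_self _ _
    · exact Finset.mem_insert_of_mem (hmP j hq)

theorem abs_mulExt (u : ℕ → (ι → ℕ) → ℝ) (n : ι → ℕ) :
    |mulExt u n| = mulExt (fun p ν => |u p ν|) n := by
  unfold mulExt
  split_ifs
  · simp
  · exact Finset.abs_prod _ _

theorem mulExt_mul (u v : ℕ → (ι → ℕ) → ℝ) (n : ι → ℕ) :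
    mulExt (fun p ν => u p ν * v p ν) n = mulExt u n * mulExt v n := by
  unfold mulExt
  split_ifs
  · simp
  · exact Finset.prod_mul_distrib

/-- Adjoining a prime p to `S` writes each coordinate uniquely as p^e · m, so the sum gains the
local factor at p. Summability is carried along the induction because multiplying two series
requires absolute convergence. -/
theorem hasSum_mulExt_factoredNumbers {u : ℕ → (ι → ℕ) → ℝ} (hu : ∀ p, u p 0 = 1)
    (hs : ∀ p, p.Prime → Summable (u p)) (S : Finset ℕ) :
    Summable (fun d : ι → Nat.factoredNumbers S => mulExt u (fun j => d j)) ∧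
    HasSum (fun d : ι → Nat.factoredNumbers S => mulExt u (fun j => d j))
      (∏ p ∈ S with p.Prime, ∑' ν, u p ν) := by
  classical
  induction S using Finset.induction_on with
  | empty =>
    have : Unique (Nat.factoredNumbers ∅) := by
      rw [Nat.factoredNumbers_empty]; infer_instance
    have h1 : ∀ d : ι → Nat.factoredNumbers ∅,
        mulExt u (fun j => (d j : ℕ)) = 1 := fun d => by
      have : (fun j => (d j : ℕ)) = fun _ => 1 := by
        funext j
        exact (Set.ext_iff.mp Nat.factoredNumbers_empty _).mp (d j).2
      rw [this, mulExt_one hu]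
    have := hasSum_unique (fun d : ι → Nat.factoredNumbers ∅ => mulExt u (fun j => (d j : ℕ)))
    rw [h1] at this
    simpa using ⟨this.summable, this⟩
  | insert p S hpS ih =>
    by_cases hp : p.Prime
    · rw [Finset.filter_insert, if_pos hp, Finset.prod_insert (by simp [hpS])]
      let e : (ι → ℕ) × (ι → Nat.factoredNumbers S) ≃ (ι → Nat.factoredNumbers (insert p S)) :=
        (Equiv.arrowProdEquivProdArrow ι (fun _ => ℕ) (fun _ => Nat.factoredNumbers S)).symm.trans
          (Equiv.piCongrRight fun _ => Nat.equivProdNatFactoredNumbers hp hpS)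
      have he : (fun d : ι → Nat.factoredNumbers (insert p S) => mulExt u (fun j => d j)) ∘ e =
          fun x : (ι → ℕ) × (ι → Nat.factoredNumbers S) =>
            u p x.1 * mulExt u (fun j => x.2 j) := by
        funext x
        rw [← mulExt_pow_mul hu hp x.1 _ (fun j => (x.2 j).2.1)]
        · rfl
        · intro j hj
          exact hp.coprime_iff_not_dvd.mp (hp.factoredNumbers_coprime hpS (x.2 j).2) hj
      have hsum : Summable fun x : (ι → ℕ) × (ι → Nat.factoredNumbers S) =>
            u p x.1 * mulExt u (fun j => x.2 j) := by
        apply summable_mul_of_summable_norm (hs p hp).norm ih.1.norm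
      have hmain := (hs p hp).hasSum.mul ih.2 hsum
      rw [← he] at hmain
      have := e.hasSum_iff.mp hmain
      exact ⟨this.summable, this⟩
    · rw [Finset.filter_insert, if_neg hp, Nat.factoredNumbers_insert S hp]
      exact ih

/-- The tuples all of whose entries have their prime factors in `S`. -/
def factoredTuples (ι : Type*) (S : Finset ℕ) : Set (ι → ℕ) :=
  {d | ∀ j, d j ∈ Nat.factoredNumbers S}

theorem mulExt_indicator_hasSum {u : ℕ → (ι → ℕ) → ℝ} (hu : ∀ p, u p 0 = 1)
    (hs : ∀ p, p.Prime → Summable (u p)) (S : Finset ℕ) :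
    HasSum (Set.indicator (factoredTuples ι S) (mulExt u))
      (∏ p ∈ S with p.Prime, ∑' ν, u p ν) := by
  have h := (hasSum_mulExt_factoredNumbers (ι := ι) hu hs S).2
  let g : (ι → Nat.factoredNumbers S) → (ι → ℕ) := fun d j => d j
  have hg : Function.Injective g := fun a b hab =>
    funext fun j => Subtype.ext (congrFun hab j)
  refine (hg.hasSum_iff ?_).mp ?_
  · intro d hd
    refine Set.indicator_of_notMem (fun hm : ∀ j, _ => hd ⟨fun j => ⟨d j, hm j⟩, rfl⟩) _
  · convert h using 1
    funext d
    exact Set.indicator_of_mem (s := factoredTuples ι S) (fun j => (d j).2) _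

/-- A multiplicative function whose local sums are close to `1` is absolutely summable. -/
theorem summable_mulExt {u : ℕ → (ι → ℕ) → ℝ} (hu : ∀ p, u p 0 = 1)
    (hs : ∀ p, p.Prime → Summable (u p)) {a : ℕ → ℝ} (ha : Summable a) (ha0 : ∀ p, 0 ≤ a p)
    (hua : ∀ p, p.Prime → ∑' ν, |u p ν| ≤ 1 + a p) : Summable (mulExt u) := by
  classical
  rw [← summable_abs_iff]
  simp_rw [abs_mulExt]
  refine summable_of_sum_le (c := Real.exp (∑' p, a p)) (fun n => ?_) fun U => ?_
  · rw [← abs_mulExt]; exact abs_nonneg _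
  -- Finitely many tuples involve only primes below some N, so their sum is at most a finite Euler
  -- product, hence at most ∏ (1 + a p) ≤ exp (∑ a p).
  have hex : ∃ N : ℕ, ∀ d ∈ U, (∀ j, d j ≠ 0) →
      ∀ j, d j ∈ Nat.factoredNumbers N.primesBelow := by
    refine ⟨(∑ d ∈ U, ∑ j, d j) + 1, fun d hdU hd j => ⟨hd j, fun p hp => ?_⟩⟩
    rw [Nat.mem_primesBelow]
    have h1 := Nat.le_of_mem_primeFactorsList hp
    have h2 : d j ≤ ∑ j, d j := Finset.single_le_sum (f := d) (by simp) (Finset.mem_univ j)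
    have h3 : ∑ j, d j ≤ ∑ d ∈ U, ∑ j, d j :=
      Finset.single_le_sum (f := fun d : ι → ℕ => ∑ j, d j) (by simp) hdU
    exact ⟨by omega, Nat.prime_of_mem_primeFactorsList hp⟩
  obtain ⟨N, hN⟩ := hex
  have hsum := mulExt_indicator_hasSum (ι := ι) (u := fun p ν => |u p ν|) (by simp [hu])
    (fun p hp => (hs p hp).abs) N.primesBelow
  calc ∑ d ∈ U, mulExt (fun p ν => |u p ν|) d
      ≤ ∑ d ∈ U, Set.indicator (factoredTuples ι N.primesBelow)
          (mulExt fun p ν => |u p ν|) d := by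
        refine Finset.sum_le_sum fun d hd => ?_
        by_cases h : ∀ j, d j ≠ 0
        · rw [Set.indicator_of_mem (show d ∈ factoredTuples ι _ from hN d hd h)]
        · push Not at h
          obtain ⟨j, hj⟩ := h
          rw [mulExt_of_eq_zero _ hj]
          refine Set.indicator_nonneg (fun d _ => ?_) _
          rw [← abs_mulExt]; exact abs_nonneg _
    _ ≤ _ := sum_le_hasSum _ (fun d _ => Set.indicator_nonneg (fun d _ => by
          rw [← abs_mulExt]; exact abs_nonneg _) _) hsum
    _ ≤ ∏ p ∈ N.primesBelow with p.Prime, Real.exp (a p) := by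
        refine Finset.prod_le_prod (fun p _ => tsum_nonneg fun ν => abs_nonneg _) fun p hp => ?_
        have := Real.add_one_le_exp (a p)
        linarith [hua p (Finset.mem_filter.mp hp).2]
    _ = Real.exp (∑ p ∈ N.primesBelow with p.Prime, a p) := (Real.exp_sum _ _).symm
    _ ≤ _ := Real.exp_le_exp.mpr (ha.sum_le_tsum _ fun p _ => ha0 p)

/-- The Euler product of an absolutely summable multiplicative function. -/
theorem hasProd_mulExt {u : ℕ → (ι → ℕ) → ℝ} (hu : ∀ p, u p 0 = 1)
    (hs : ∀ p, p.Prime → Summable (u p)) (h : Summable (mulExt u)) :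
    HasProd (fun p : Nat.Primes => ∑' ν, u p ν) (∑' d, mulExt u d) := by
  classical
  -- Partial Euler products are sums over indicators that exhaust all tuples without a zero entry;
  -- dominated convergence with majorant |`mulExt u`| gives the limit.
  have key : ∀ S : Finset Nat.Primes, ∏ p ∈ S, ∑' ν, u p ν =
      ∑' d, Set.indicator (factoredTuples ι
        (S.map ⟨fun p : Nat.Primes => (p : ℕ), Subtype.coe_injective⟩)) (mulExt u) d := fun S => by
    rw [(mulExt_indicator_hasSum hu hs _).tsum_eq, Finset.filter_true_of_mem, Finset.prod_map]
    · rfl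
    · intro p hp
      obtain ⟨q, -, rfl⟩ := Finset.mem_map.mp hp
      exact q.2
  rw [HasProd, SummationFilter.unconditional_filter]
  simp_rw [key]
  refine tendsto_tsum_of_dominated_convergence h.abs (fun d => ?_) (Eventually.of_forall fun S d => ?_)
  · by_cases hd : ∀ j, d j ≠ 0
    · let S₀ : Finset Nat.Primes := (∏ j, d j).primeFactors.subtype _
      refine tendsto_const_nhds.congr' ?_
      filter_upwards [eventually_ge_atTop S₀] with S hS
      refine (Set.indicator_of_mem (s := factoredTuples ι _) (fun j => ⟨hd j, fun p hp => ?_⟩) _).symm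
      have hp' := Nat.prime_of_mem_primeFactorsList hp
      refine Finset.mem_map.mpr ⟨⟨p, hp'⟩, hS ?_, rfl⟩
      refine Finset.mem_subtype.mpr ?_
      exact Nat.mem_primeFactors.mpr ⟨hp', (Nat.dvd_of_mem_primeFactorsList hp).trans
        (Finset.dvd_prod_of_mem d (Finset.mem_univ j)),
        Finset.prod_ne_zero_iff.mpr fun j _ => hd j⟩
    · push Not at hd
      obtain ⟨j, hj⟩ := hd
      simp [Set.indicator_apply, mulExt_of_eq_zero u hj]
  · exact norm_indicator_le_norm_self _ _

end DivisorAverages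

/-! ### Dirichlet convolution in several variables. -/

namespace DivisorAverages

variable {ι : Type*} [Fintype ι]

/-- Multiplicative functions of several variables whose local values are convolutions are
Dirichlet convolutions. -/
theorem mulExt_convolution [DecidableEq ι] {w c t : (ι → ℕ) → ℝ} (hw : w 0 = 1) (hc : c 0 = 1)
    (ht : t 0 = 1)
    (h : ∀ ν, w ν = ∑ a ∈ Fintype.piFinset (fun j => Finset.range (ν j + 1)), c a * t (ν - a))
    {n : ι → ℕ} (hn : ∀ j, n j ≠ 0) :
    mulExt (fun _ => w) n = ∑ d ∈ Fintype.piFinset (fun j => (n j).divisors),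
      mulExt (fun _ => c) d * mulExt (fun _ => t) (fun j => n j / d j) := by
  have h0 : ∏ j, n j ≠ 0 := Finset.prod_ne_zero_iff.mpr fun j _ => hn j
  set P := (∏ j, n j).primeFactors with hP
  have hmP : ∀ j, (n j).primeFactors ⊆ P := fun j =>
    Nat.primeFactors_mono (Finset.dvd_prod_of_mem n (Finset.mem_univ j)) h0
  rw [mulExt_eq_prod (fun _ => hw) hn hmP]
  simp_rw [h]
  rw [Finset.prod_sum]
  symm
  have hdvd : ∀ d ∈ Fintype.piFinset (fun j => (n j).divisors), ∀ j, d j ∣ n j := fun d hd j =>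
    Nat.dvd_of_mem_divisors (Fintype.mem_piFinset.mp hd j)
  have hd0 : ∀ d ∈ Fintype.piFinset (fun j => (n j).divisors), ∀ j, d j ≠ 0 := fun d hd j =>
    ne_zero_of_dvd_ne_zero (hn j) (hdvd d hd j)
  have hdP : ∀ d ∈ Fintype.piFinset (fun j => (n j).divisors), ∀ j, (d j).primeFactors ⊆ P :=
    fun d hd j => (Nat.primeFactors_mono (hdvd d hd j) (hn j)).trans (hmP j)
  -- Unique factorization: a tuple of divisors of n amounts to an independent choice, for each p in
  -- `P`, of an exponent vector below that of n.
  refine Finset.sum_bij (fun d _ p _ => expVec d p) ?_ ?_ ?_ ?_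
  · intro d hd
    refine Finset.mem_pi.mpr fun p _ => Fintype.mem_piFinset.mpr fun j => ?_
    rw [Finset.mem_range, Nat.lt_succ_iff]
    exact (Nat.factorization_le_iff_dvd (hd0 d hd j) (hn j)).mpr (hdvd d hd j) p
  · intro d hd d' hd' hdd
    funext j
    refine Nat.eq_of_factorization_eq (hd0 d hd j) (hd0 d' hd' j) fun p => ?_
    by_cases hp : p ∈ P
    · exact congrFun (congrFun (congrFun hdd p) hp) j
    · rw [Finsupp.notMem_support_iff.mp fun hh => hp (hdP d hd j hh),
        Finsupp.notMem_support_iff.mp fun hh => hp (hdP d' hd' j hh)]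
  · intro φ hφ
    let g : ι → ℕ →₀ ℕ := fun j => Finsupp.onFinset P
      (fun p => if hp : p ∈ P then φ p hp j else 0) (fun p hp => by
        by_contra hp'
        simp [hp'] at hp)
    have hgP : ∀ j, ∀ p ∈ (g j).support, p.Prime := fun j p hp =>
      Nat.prime_of_mem_primeFactors (Finsupp.support_onFinset_subset hp)
    have hfac : ∀ j, ((g j).prod (· ^ ·)).factorization = g j := fun j =>
      Nat.prod_pow_factorization_eq_self (hgP j)
    have hne : ∀ j, (g j).prod (· ^ ·) ≠ 0 := fun j =>
      Finset.prod_ne_zero_iff.mpr fun p hp => pow_ne_zero _ (hgP j p hp).ne_zero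
    refine ⟨fun j => (g j).prod (· ^ ·), ?_, ?_⟩
    · refine Fintype.mem_piFinset.mpr fun j => Nat.mem_divisors.mpr ⟨?_, hn j⟩
      refine (Nat.factorization_le_iff_dvd (hne j) (hn j)).mp fun p => ?_
      rw [hfac]
      by_cases hp : p ∈ P
      · have := Fintype.mem_piFinset.mp (Finset.mem_pi.mp hφ p hp) j
        rw [Finset.mem_range, Nat.lt_succ_iff] at this
        simpa [g, hp, expVec] using this
      · simp [g, hp]
    · funext p hp j
      simp only [expVec, hfac]
      simp [g, hp]
  · intro d hd
    have hq : ∀ j, n j / d j ≠ 0 := fun j =>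
      (Nat.div_pos (Nat.le_of_dvd (Nat.pos_of_ne_zero (hn j)) (hdvd d hd j))
        (Nat.pos_of_ne_zero (hd0 d hd j))).ne'
    have hqP : ∀ j, (n j / d j).primeFactors ⊆ P := fun j =>
      (Nat.primeFactors_mono (Nat.div_dvd_of_dvd (hdvd d hd j)) (hn j)).trans (hmP j)
    rw [mulExt_eq_prod (fun _ => hc) (hd0 d hd) (hdP d hd),
      mulExt_eq_prod (fun _ => ht) hq hqP, ← Finset.prod_mul_distrib, ← Finset.prod_attach]
    refine Finset.prod_congr rfl fun p _ => ?_
    congr 2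
    funext j
    simp [expVec, Nat.factorization_div (hdvd d hd j)]

/-- Substitute n_j = d_j m_j and sum over d first; the condition n_j ≤ x becomes m_j ≤ x / d_j. -/
theorem sum_box_convolution {r : ℕ} (f c t : (Fin r → ℕ) → ℝ)
    (h : ∀ n : Fin r → ℕ, (∀ j, n j ≠ 0) →
      f n = ∑ d ∈ Fintype.piFinset (fun j => (n j).divisors), c d * t (fun j => n j / d j))
    (x : ℝ) :
    ∑ n ∈ box r x, f n = ∑ d ∈ box r x, c d *
      ∑ m ∈ Fintype.piFinset (fun j => Finset.Icc 1 ⌊x / d j⌋₊), t m := by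
  have hb : ∀ n ∈ box r x, f n =
      ∑ d ∈ Fintype.piFinset (fun j => (n j).divisors), c d * t (fun j => n j / d j) :=
    fun n hn => h n fun j => by
      have := Fintype.mem_piFinset.mp hn j
      rw [Finset.mem_Icc] at this
      omega
  rw [Finset.sum_congr rfl hb]
  simp_rw [Finset.mul_sum]
  rw [Finset.sum_sigma', Finset.sum_sigma']
  refine Finset.sum_bij' (fun a _ => ⟨a.2, fun j => a.1 j / a.2 j⟩)
    (fun a _ => ⟨fun j => a.1 j * a.2 j, a.1⟩) ?_ ?_ ?_ ?_ ?_
  · rintro ⟨n, d⟩ h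
    simp only [box, Finset.mem_sigma, Fintype.mem_piFinset, Finset.mem_Icc,
      Nat.floor_div_natCast, Nat.mem_divisors] at h ⊢
    have hd : ∀ j, 0 < d j := fun j => Nat.pos_of_dvd_of_pos (h.2 j).1 (h.1 j).1
    have hdn : ∀ j, d j ≤ n j := fun j => Nat.le_of_dvd (h.1 j).1 (h.2 j).1
    exact ⟨fun j => ⟨hd j, (hdn j).trans (h.1 j).2⟩,
      fun j => ⟨Nat.div_pos (hdn j) (hd j), Nat.div_le_div_right (h.1 j).2⟩⟩
  · rintro ⟨d, m⟩ h
    simp only [box, Finset.mem_sigma, Fintype.mem_piFinset, Finset.mem_Icc,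
      Nat.floor_div_natCast, Nat.mem_divisors] at h ⊢
    refine ⟨fun j => ⟨Nat.mul_pos (h.1 j).1 (h.2 j).1, ?_⟩,
      fun j => ⟨Dvd.intro _ rfl, (Nat.mul_pos (h.1 j).1 (h.2 j).1).ne'⟩⟩
    rw [mul_comm]
    exact (Nat.le_div_iff_mul_le (h.1 j).1).mp (h.2 j).2
  · rintro ⟨n, d⟩ h
    simp only [Finset.mem_sigma, Fintype.mem_piFinset, Nat.mem_divisors] at h
    simp only [Sigma.mk.injEq, heq_eq_eq, and_true]
    funext j
    exact Nat.mul_div_cancel' (h.2 j).1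
  · rintro ⟨d, m⟩ h
    simp only [box, Finset.mem_sigma, Fintype.mem_piFinset, Finset.mem_Icc] at h
    simp only [Sigma.mk.injEq, heq_eq_eq, true_and]
    funext j
    exact Nat.mul_div_cancel_left _ (h.1 j).1
  · rintro ⟨n, d⟩ _
    rfl

end DivisorAverages

/-! ### Local power series and division by the series of τ ⊗ ⋯ ⊗ τ. -/

namespace DivisorAverages

variable {ι : Type*} [Fintype ι]

/-- The coefficients of `(1 - X) * (1 - X ^ k)`. -/
noncomputable def invCoeff (k m : ℕ) : ℝ :=
  (if m = 0 then 1 else 0) - (if m = 1 then 1 else 0) - (if m = k then 1 else 0)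
    + (if m = k + 1 then 1 else 0)

theorem sum_range_invCoeff_pow (k : ℕ) (x : ℝ) :
    ∑ e ∈ Finset.range (k + 2), invCoeff k e * x ^ e = (1 - x) * (1 - x ^ k) := by
  simp only [invCoeff, sub_mul, add_mul, ite_mul, one_mul, zero_mul, Finset.sum_add_distrib,
    Finset.sum_sub_distrib, Finset.sum_ite_eq', Finset.mem_range]
  simp
  ring

/-- Coefficient form of the identity ∑ (⌊m/k⌋ + 1) X^m = 1 / ((1 - X)(1 - X^k)). -/
theorem sum_range_invCoeff_mul {k : ℕ} (hk : 1 ≤ k) (m : ℕ) :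
    ∑ e ∈ Finset.range (m + 1), invCoeff k e * ((m - e) / k + 1 : ℕ) =
      if m = 0 then 1 else 0 := by
  simp only [invCoeff, sub_mul, add_mul, ite_mul, one_mul, zero_mul, Finset.sum_add_distrib,
    Finset.sum_sub_distrib, Finset.sum_ite_eq', Finset.mem_range]
  have hdiv : ∀ a, k ≤ a → (a - k) / k + 1 = a / k := fun a ha => by
    conv_rhs => rw [← Nat.sub_add_cancel ha, Nat.add_div_right _ hk]
  rcases Nat.eq_zero_or_pos m with rfl | hm
  · simp [(Nat.one_le_iff_ne_zero.mp hk)]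
  have h1 : 1 < m + 1 := by omega
  simp only [Nat.succ_pos', if_true, h1, hm.ne', if_false, Nat.sub_zero]
  rcases lt_trichotomy m k with h | rfl | h
  · rw [if_neg (by omega), if_neg (by omega), Nat.div_eq_of_lt h,
      Nat.div_eq_of_lt (by omega : m - 1 < k)]
    simp
  · rw [if_pos (by omega), if_neg (by omega), Nat.div_self hm,
      Nat.div_eq_of_lt (by omega : m - 1 < m)]
    norm_num
  · rw [if_pos (by omega), if_pos (by omega), hdiv m h.le, ← hdiv (m - 1) (by omega),
      show m - 1 - k = m - (k + 1) by omega]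
    push_cast
    ring

/-- The coefficients of `∏ j, (1 - X j) * (1 - X j ^ k)` times the power series with
coefficients `w`. -/
noncomputable def convCoeff [DecidableEq ι] (k : ℕ) (w : (ι → ℕ) → ℝ) (ν : ι → ℕ) : ℝ :=
  ∑ e ∈ Fintype.piFinset (fun j => Finset.range (ν j + 1)), (∏ j, invCoeff k (e j)) * w (ν - e)

theorem convCoeff_convolution [DecidableEq ι] {k : ℕ} (hk : 1 ≤ k) (w : (ι → ℕ) → ℝ)
    (ν : ι → ℕ) :
    w ν = ∑ a ∈ Fintype.piFinset (fun j => Finset.range (ν j + 1)),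
      convCoeff k w a * ∏ j, ((((ν - a) j) / k + 1 : ℕ) : ℝ) := by
  have h1 : ∀ b ∈ Fintype.piFinset (fun j => Finset.range (ν j + 1)),
      w b * ∑ e ∈ Fintype.piFinset (fun j => Finset.range ((ν - b) j + 1)),
        ∏ j, invCoeff k (e j) * ((((ν - b) j - e j) / k + 1 : ℕ) : ℝ) =
      if b = ν then w ν else 0 := by
    intro b hb
    rw [← Finset.prod_univ_sum (fun j => Finset.range ((ν - b) j + 1))
      (fun j e => invCoeff k e * ((((ν - b) j - e) / k + 1 : ℕ) : ℝ))]
    simp_rw [sum_range_invCoeff_mul hk]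
    have hb' : ∀ j, b j ≤ ν j := fun j => by
      have := Fintype.mem_piFinset.mp hb j
      rw [Finset.mem_range] at this
      omega
    split_ifs with h
    · subst h
      simp
    · obtain ⟨j, hj⟩ := Function.ne_iff.mp h
      rw [Finset.prod_eq_zero (Finset.mem_univ j), mul_zero]
      rw [if_neg]
      have := hb' j
      simp only [Pi.sub_apply]
      omega
  have h2 := Finset.sum_congr rfl h1
  rw [Finset.sum_ite_eq', if_pos (Fintype.mem_piFinset.mpr fun j => by simp)] at h2
  rw [← h2]
  simp_rw [convCoeff, Finset.sum_mul, Finset.mul_sum]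
  rw [Finset.sum_sigma', Finset.sum_sigma']
  -- Associativity of the convolution, through the reindexing a = b + e; the sum over e for fixed b
  -- has already collapsed to b = ν.
  refine Finset.sum_bij' (fun a _ => ⟨a.1 + a.2, a.2⟩) (fun a _ => ⟨a.1 - a.2, a.2⟩)
    ?_ ?_ ?_ ?_ ?_
  · rintro ⟨b, e⟩ h
    simp only [Finset.mem_sigma, Fintype.mem_piFinset, Finset.mem_range, Pi.sub_apply,
      Pi.add_apply] at h ⊢
    exact ⟨fun j => by have := h.1 j; have := h.2 j; omega, fun j => by omega⟩
  · rintro ⟨a, e⟩ h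
    simp only [Finset.mem_sigma, Fintype.mem_piFinset, Finset.mem_range, Pi.sub_apply] at h ⊢
    exact ⟨fun j => by have := h.1 j; have := h.2 j; omega,
      fun j => by have := h.1 j; have := h.2 j; omega⟩
  · rintro ⟨b, e⟩ h
    simp
  · rintro ⟨a, e⟩ h
    simp only [Finset.mem_sigma, Fintype.mem_piFinset, Finset.mem_range] at h
    simp only [Sigma.mk.injEq, heq_eq_eq, and_true]
    funext j
    have := h.2 j
    simp only [Pi.add_apply, Pi.sub_apply]
    omega
  · rintro ⟨b, e⟩ h
    simp only [add_tsub_cancel_right, Finset.prod_mul_distrib]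
    have : ∀ j, (ν - (b + e)) j = (ν - b) j - e j := fun j => by
      simp only [Pi.sub_apply, Pi.add_apply]; omega
    simp_rw [this]
    ring

/-- The coefficient at ν sees only the values of `w` below ν, so agreement there with the product
weight gives the coefficient of the constant series 1. -/
theorem convCoeff_of_eq_prod [DecidableEq ι] {k : ℕ} (hk : 1 ≤ k) {w : (ι → ℕ) → ℝ} {ν : ι → ℕ}
    (h : ∀ b ≤ ν, w b = ∏ j, ((b j / k + 1 : ℕ) : ℝ)) :
    convCoeff k w ν = ∏ j, if ν j = 0 then 1 else 0 := by
  simp_rw [← sum_range_invCoeff_mul hk]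
  rw [Finset.prod_univ_sum, convCoeff]
  refine Finset.sum_congr rfl fun e _ => ?_
  rw [h _ tsub_le_self, Finset.prod_mul_distrib]
  rfl

/-- `invCoeff k` vanishes beyond k + 1. The index set thus becomes finite and independent of ν, and
the sum over e can be interchanged with the series in ν. -/
theorem convCoeff_eq_sum_ite [DecidableEq ι] (k : ℕ) (w : (ι → ℕ) → ℝ) (ν : ι → ℕ) :
    convCoeff k w ν = ∑ e ∈ Fintype.piFinset (fun _ : ι => Finset.range (k + 2)),
      if ∀ j, e j ≤ ν j then (∏ j, invCoeff k (e j)) * w (ν - e) else 0 := by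
  rw [← Finset.sum_filter, convCoeff]
  symm
  apply Finset.sum_subset
  · intro e he
    rw [Finset.mem_filter] at he
    exact Fintype.mem_piFinset.mpr fun j => Finset.mem_range.mpr (Nat.lt_succ_iff.mpr (he.2 j))
  · intro e he he'
    have hle : e ≤ ν := fun j =>
      Nat.lt_succ_iff.mp (Finset.mem_range.mp (Fintype.mem_piFinset.mp he j))
    have : ¬ ∀ j, e j < k + 2 := fun hh => he' (Finset.mem_filter.mpr
      ⟨Fintype.mem_piFinset.mpr fun j => Finset.mem_range.mpr (hh j), hle⟩)
    push Not at this
    obtain ⟨j, hj⟩ := this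
    rw [Finset.prod_eq_zero (Finset.mem_univ j), zero_mul]
    have h0 : e j ≠ 0 := by omega
    have h1 : e j ≠ 1 := by omega
    have h2 : e j ≠ k := by omega
    have h3 : e j ≠ k + 1 := by omega
    simp [invCoeff, h0, h1, h2, h3]

theorem hasSum_convCoeff [DecidableEq ι] (k : ℕ) {w : (ι → ℕ) → ℝ} {x : ι → ℝ}
    (hs : Summable fun ν : ι → ℕ => w ν * ∏ j, x j ^ ν j) :
    HasSum (fun ν : ι → ℕ => convCoeff k w ν * ∏ j, x j ^ ν j)
      ((∏ j, (1 - x j) * (1 - x j ^ k)) * ∑' ν : ι → ℕ, w ν * ∏ j, x j ^ ν j) := by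
  simp_rw [← sum_range_invCoeff_pow]
  rw [Finset.prod_univ_sum, Finset.sum_mul]
  simp_rw [convCoeff_eq_sum_ite, Finset.sum_mul]
  refine hasSum_sum fun e _ => ?_
  have hinj : Function.Injective fun ν : ι → ℕ => ν + e := add_left_injective e
  refine (hinj.hasSum_iff ?_).mp ?_
  · intro ν hν
    have : ¬ ∀ j, e j ≤ ν j := fun h => hν ⟨ν - e, tsub_add_cancel_of_le h⟩
    rw [if_neg this, zero_mul]
  · refine (hs.hasSum.mul_left (∏ j, invCoeff k (e j) * x j ^ e j)).congr_fun fun ν => ?_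
    simp only [Function.comp_apply, add_tsub_cancel_right, Pi.add_apply, pow_add,
      Finset.prod_mul_distrib]
    rw [if_pos (fun j => Nat.le_add_left _ _)]
    ring

theorem summable_prod_pi [DecidableEq ι] {g : ι → ℕ → ℝ} (h0 : ∀ j m, 0 ≤ g j m)
    (hg : ∀ j, Summable (g j)) : Summable fun ν : ι → ℕ => ∏ j, g j (ν j) := by
  refine summable_of_sum_le (c := ∏ j, ∑' m, g j m)
    (fun ν => Finset.prod_nonneg fun j _ => h0 j _) fun U => ?_
  have hU : U ⊆ Fintype.piFinset fun j => U.image (fun ν => ν j) := fun ν hν =>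
    Fintype.mem_piFinset.mpr fun j => Finset.mem_image_of_mem _ hν
  refine (Finset.sum_le_sum_of_subset_of_nonneg hU
    fun ν _ _ => Finset.prod_nonneg fun j _ => h0 j _).trans ?_
  rw [← Finset.prod_univ_sum]
  exact Finset.prod_le_prod (fun j _ => Finset.sum_nonneg fun m _ => h0 j m)
    fun j _ => (hg j).sum_le_tsum _ fun m _ => h0 j m

theorem summable_mul_prod_pow [DecidableEq ι] {w : (ι → ℕ) → ℝ} (hw0 : ∀ ν, 0 ≤ w ν)
    (hw : ∀ ν, w ν ≤ ∏ j, ((ν j : ℝ) + 1)) {x : ι → ℝ} (hx0 : ∀ j, 0 ≤ x j)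
    (hx1 : ∀ j, x j < 1) : Summable fun ν : ι → ℕ => w ν * ∏ j, x j ^ ν j := by
  have hp : ∀ ν : ι → ℕ, 0 ≤ ∏ j, x j ^ ν j := fun ν =>
    Finset.prod_nonneg fun j _ => pow_nonneg (hx0 j) _
  have hg : ∀ j, Summable fun m : ℕ => ((m : ℝ) + 1) * x j ^ m := fun j => by
    have hx : ‖x j‖ < 1 := by rw [Real.norm_of_nonneg (hx0 j)]; exact hx1 j
    have h1 := summable_pow_mul_geometric_of_norm_lt_one 1 hx
    have h2 := summable_geometric_of_norm_lt_one hx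
    refine (h1.add h2).congr fun m => ?_
    ring
  refine Summable.of_nonneg_of_le (fun ν => mul_nonneg (hw0 ν) (hp ν)) (fun ν => ?_)
    (summable_prod_pi (fun j m => mul_nonneg (by positivity) (pow_nonneg (hx0 j) m)) hg)
  rw [Finset.prod_mul_distrib]
  exact mul_le_mul_of_nonneg_right (hw ν) (hp ν)

end DivisorAverages

/-! ### Divisor weights, the corrector h, and convergence of its Dirichlet series. -/

namespace DivisorAverages

/-- The properties of `prodWeight r k` and `lcmWeight r k` which the asymptotics depend on. -/
structure IsDivisorWeight {r : ℕ} (k : ℕ) (w : (Fin r → ℕ) → ℕ) : Prop where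
  le_prod : ∀ ν, w ν ≤ ∏ j, (ν j + 1)
  axis : ∀ ν : Fin r → ℕ, (∀ i j, ν i ≠ 0 → ν j ≠ 0 → i = j) → w ν = ∏ j, (ν j / k + 1)
  symm : ∀ (σ : Equiv.Perm (Fin r)) (ν : Fin r → ℕ), w (ν ∘ σ) = w ν

theorem sum_add_one_le_prod {ι : Type*} [Fintype ι] (ν : ι → ℕ) :
    ∑ j, ν j + 1 ≤ ∏ j, (ν j + 1) := by
  classical
  have : ∀ s : Finset ι, ∑ j ∈ s, ν j + 1 ≤ ∏ j ∈ s, (ν j + 1) := fun s => by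
    induction s using Finset.induction_on with
    | empty => simp
    | insert a s ha ih =>
      rw [Finset.sum_insert ha, Finset.prod_insert ha]
      nlinarith [Nat.zero_le (ν a), Nat.zero_le (∑ j ∈ s, ν j)]
  exact this _

theorem eq_single_of_axis {r : ℕ} {ν : Fin r → ℕ} (h : ∀ i j, ν i ≠ 0 → ν j ≠ 0 → i = j) :
    ν = 0 ∨ ∃ i, ν = Pi.single i (ν i) := by
  by_cases h0 : ν = 0
  · exact Or.inl h0
  · obtain ⟨i, hi⟩ := Function.ne_iff.mp h0
    refine Or.inr ⟨i, funext fun j => ?_⟩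
    by_cases hj : j = i
    · subst hj; simp
    · rw [Pi.single_eq_of_ne hj]
      by_contra hne
      exact hj (h j i hne hi)

theorem isDivisorWeight_of_axis {r k : ℕ} {g : (Fin r → ℕ) → ℕ}
    (hle : ∀ ν, g ν ≤ ∑ j, ν j) (hsingle : ∀ i m, g (Pi.single i m) = m)
    (hsymm : ∀ (σ : Equiv.Perm (Fin r)) (ν : Fin r → ℕ), g (ν ∘ σ) = g ν) :
    IsDivisorWeight k fun ν => g ν / k + 1 where
  le_prod ν := (Nat.succ_le_succ ((Nat.div_le_self _ _).trans (hle ν))).trans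
    (sum_add_one_le_prod ν)
  axis ν h := by
    rcases eq_single_of_axis h with h | ⟨i, hi⟩
    · have : g ν = 0 := by simpa [h] using hle ν
      rw [this]
      simp [h]
    · rw [hi, hsingle, Finset.prod_eq_single i]
      · simp
      · intro j _ hj
        simp [Pi.single_eq_of_ne hj]
      · simp
  symm σ ν := by rw [hsymm]

theorem isDivisorWeight_prodWeight (r k : ℕ) : IsDivisorWeight k (prodWeight r k) :=
  isDivisorWeight_of_axis (g := fun ν => ∑ j, ν j) (fun _ => le_rfl) (fun i m => by simp)
    fun σ ν => Equiv.sum_comp σ ν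

theorem isDivisorWeight_lcmWeight (r k : ℕ) : IsDivisorWeight k (lcmWeight r k) := by
  refine isDivisorWeight_of_axis (g := fun ν => Finset.univ.sup ν)
    (fun ν => Finset.sup_le fun j hj => Finset.single_le_sum (by simp) hj) (fun i m => ?_)
    fun σ ν => ?_
  · refine le_antisymm (Finset.sup_le fun j _ => ?_) ?_
    · by_cases hj : j = i
      · subst hj; simp
      · simp [Pi.single_eq_of_ne hj]
    · have := Finset.le_sup (f := (Pi.single i m : Fin r → ℕ)) (Finset.mem_univ i)
      simpa using this
  · refine le_antisymm (Finset.sup_le fun j _ => Finset.le_sup (Finset.mem_univ (σ j)))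
      (Finset.sup_le fun j _ => ?_)
    have := Finset.le_sup (f := ν ∘ σ) (Finset.mem_univ (σ.symm j))
    simpa using this

variable {r k : ℕ} {w : (Fin r → ℕ) → ℕ}

/-- The local coefficients of the multiplicative function `h` for which the function with local
values `w` is the convolution of `h` and `τ_{1,k} ⊗ ⋯ ⊗ τ_{1,k}`. -/
noncomputable def localCoeff (k : ℕ) (w : (Fin r → ℕ) → ℕ) : (Fin r → ℕ) → ℝ :=
  convCoeff k fun ν => (w ν : ℝ)

/-- The decisive cancellation: everything below a point of an axis lies on that axis, where `w` is
the product weight. All axis coefficients except the one at 0 therefore vanish. -/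
theorem IsDivisorWeight.localCoeff_axis (hw : IsDivisorWeight k w) (hk : 1 ≤ k)
    {ν : Fin r → ℕ} (h : ∀ i j, ν i ≠ 0 → ν j ≠ 0 → i = j) :
    localCoeff k w ν = ∏ j, if ν j = 0 then 1 else 0 := by
  refine convCoeff_of_eq_prod hk fun b hb => ?_
  rw [hw.axis b fun i j hi hj => h i j (fun h0 => hi (by simpa [h0] using hb i))
    fun h0 => hj (by simpa [h0] using hb j), Nat.cast_prod]

theorem IsDivisorWeight.localCoeff_zero (hw : IsDivisorWeight k w) (hk : 1 ≤ k) :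
    localCoeff k w 0 = 1 := by
  rw [hw.localCoeff_axis hk (by simp)]
  simp

theorem IsDivisorWeight.apply_zero (hw : IsDivisorWeight k w) : w 0 = 1 := by
  rw [hw.axis 0 (by simp)]
  simp

theorem rpow_sum_mul {p : ℝ} (hp : 0 < p) (s : Fin r → ℝ) (ν : Fin r → ℕ) :
    ∏ j, (p ^ (-s j)) ^ ν j = p ^ (-∑ j, (ν j : ℝ) * s j) := by
  rw [← Finset.sum_neg_distrib, Real.rpow_sum_of_pos hp]
  refine Finset.prod_congr rfl fun j _ => ?_
  rw [← Real.rpow_natCast, ← Real.rpow_mul hp.le]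
  congr 1
  ring

theorem localTerm_eq {p : ℕ} (hp : 0 < p) (s : Fin r → ℝ) (ν : Fin r → ℕ) :
    localTerm w s p ν = (w ν : ℝ) * ∏ j, ((p : ℝ) ^ (-s j)) ^ ν j := by
  have hp' : (0 : ℝ) < p := Nat.cast_pos.mpr hp
  rw [localTerm, rpow_sum_mul hp', Real.rpow_neg hp'.le, div_eq_mul_inv]

theorem rpow_neg_lt_one_of_prime {p : ℕ} (hp : p.Prime) {s : ℝ} (hs : 0 < s) :
    (p : ℝ) ^ (-s) < 1 :=
  Real.rpow_lt_one_of_one_lt_of_neg (Nat.one_lt_cast.mpr hp.one_lt) (neg_neg_of_pos hs)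

theorem IsDivisorWeight.summable (hw : IsDivisorWeight k w) {x : Fin r → ℝ} (hx0 : ∀ j, 0 ≤ x j)
    (hx1 : ∀ j, x j < 1) : Summable fun ν : Fin r → ℕ => (w ν : ℝ) * ∏ j, x j ^ ν j :=
  summable_mul_prod_pow (fun ν => Nat.cast_nonneg _)
    (fun ν => by exact_mod_cast hw.le_prod ν) hx0 hx1

theorem IsDivisorWeight.summable_localTerm (hw : IsDivisorWeight k w) {s : Fin r → ℝ}
    (hs : ∀ j, 0 < s j) {p : ℕ} (hp : p.Prime) : Summable (localTerm w s p) := by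
  refine (hw.summable (x := fun j => (p : ℝ) ^ (-s j)) (fun j => by positivity)
    fun j => rpow_neg_lt_one_of_prime hp (hs j)).congr fun ν => ?_
  rw [localTerm_eq hp.pos]

/-- The terms of the local factors of `h` at the point `s`. -/
noncomputable def coeffTerm (k : ℕ) (w : (Fin r → ℕ) → ℕ) (s : Fin r → ℝ) (p : ℕ)
    (ν : Fin r → ℕ) : ℝ :=
  localCoeff k w ν * ∏ j, ((p : ℝ) ^ (-s j)) ^ ν j

theorem IsDivisorWeight.hasSum_coeffTerm (hw : IsDivisorWeight k w) {s : Fin r → ℝ}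
    (hs : ∀ j, 0 < s j) {p : ℕ} (hp : p.Prime) :
    HasSum (coeffTerm k w s p) (secondFactor k w s p) := by
  have h := hasSum_convCoeff k (hw.summable (x := fun j => (p : ℝ) ^ (-s j))
    (fun j => by positivity) fun j => rpow_neg_lt_one_of_prime hp (hs j))
  suffices e : secondFactor k w s p = (∏ j, (1 - (p : ℝ) ^ (-s j)) * (1 - ((p : ℝ) ^ (-s j)) ^ k)) *
      ∑' ν : Fin r → ℕ, (w ν : ℝ) * ∏ j, ((p : ℝ) ^ (-s j)) ^ ν j by
    rw [e]; exact h
  unfold secondFactor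
  congr 1
  · refine Finset.prod_congr rfl fun j _ => ?_
    rw [← Real.rpow_natCast, ← Real.rpow_mul (Nat.cast_nonneg p)]
    congr 3
    ring
  · exact tsum_congr fun ν => localTerm_eq hp.pos s ν

theorem IsDivisorWeight.coeffTerm_zero (hw : IsDivisorWeight k w) (hk : 1 ≤ k)
    (s : Fin r → ℝ) (p : ℕ) : coeffTerm k w s p 0 = 1 := by
  simp [coeffTerm, hw.localCoeff_zero hk]

/-- Comparison with the prime 2. Off the axes the total exponent A is at least 1 + δ, so (p/2)^(-A)
≤ (p/2)^(-(1+δ)). Summing over ν then bounds all primes by the one convergent series at p = 2. -/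
theorem IsDivisorWeight.abs_coeffTerm_le (hw : IsDivisorWeight k w) (hk : 1 ≤ k) {s : Fin r → ℝ}
    {δ : ℝ} (hs : ∀ j, 0 < s j) (hs2 : ∀ i j, i ≠ j → 1 + δ ≤ s i + s j) {p : ℕ}
    (hp : p.Prime) (ν : Fin r → ℕ) :
    |coeffTerm k w s p ν| ≤ (if ν = 0 then 1 else 0) +
      2 ^ (1 + δ) * |coeffTerm k w s 2 ν| * (p : ℝ) ^ (-(1 + δ)) := by
  by_cases h : ∀ i j, ν i ≠ 0 → ν j ≠ 0 → i = j
  · have : |coeffTerm k w s p ν| ≤ if ν = 0 then 1 else 0 := by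
      split_ifs with h0
      · rw [h0, hw.coeffTerm_zero hk]; simp
      · obtain ⟨j, hj⟩ := Function.ne_iff.mp h0
        rw [coeffTerm, hw.localCoeff_axis hk h, Finset.prod_eq_zero (Finset.mem_univ j)]
        · simp
        · exact if_neg hj
    refine this.trans (le_add_of_nonneg_right ?_)
    positivity
  · push Not at h
    obtain ⟨i, j, hi, hj, hij⟩ := h
    have hν : ν ≠ 0 := fun h0 => hi (by simp [h0])
    have hA : 1 + δ ≤ ∑ l, (ν l : ℝ) * s l := by
      have hi1 : (1 : ℝ) ≤ ν i := by exact_mod_cast Nat.one_le_iff_ne_zero.mpr hi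
      have hj1 : (1 : ℝ) ≤ ν j := by exact_mod_cast Nat.one_le_iff_ne_zero.mpr hj
      have h1 : ∑ l ∈ {i, j}, (ν l : ℝ) * s l ≤ ∑ l, (ν l : ℝ) * s l :=
        Finset.sum_le_sum_of_subset_of_nonneg (Finset.subset_univ _)
          fun l _ _ => mul_nonneg (Nat.cast_nonneg _) (hs l).le
      rw [Finset.sum_pair hij] at h1
      nlinarith [hs i, hs j, hs2 i j hij]
    set A := ∑ l, (ν l : ℝ) * s l
    have hp2 : (1 : ℝ) ≤ (p : ℝ) / 2 := by
      rw [le_div_iff₀ two_pos]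
      exact_mod_cast (by simpa using hp.two_le)
    have hp0 : (0 : ℝ) < p := Nat.cast_pos.mpr hp.pos
    have key : (p : ℝ) ^ (-A) ≤ 2 ^ (1 + δ) * (2 : ℝ) ^ (-A) * (p : ℝ) ^ (-(1 + δ)) := by
      have h1 : ((p : ℝ) / 2) ^ (-A) ≤ ((p : ℝ) / 2) ^ (-(1 + δ)) :=
        Real.rpow_le_rpow_of_exponent_le hp2 (neg_le_neg hA)
      rw [Real.div_rpow hp0.le two_pos.le, Real.div_rpow hp0.le two_pos.le,
        Real.rpow_neg two_pos.le (1 + δ), div_inv_eq_mul, div_le_iff₀ (by positivity)] at h1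
      linarith
    rw [if_neg hν, zero_add, coeffTerm, coeffTerm, abs_mul, abs_mul, rpow_sum_mul hp0,
      Nat.cast_ofNat, rpow_sum_mul two_pos, abs_of_pos (Real.rpow_pos_of_pos hp0 _),
      abs_of_pos (Real.rpow_pos_of_pos two_pos _)]
    calc _ ≤ |localCoeff k w ν| * (2 ^ (1 + δ) * (2 : ℝ) ^ (-A) * (p : ℝ) ^ (-(1 + δ))) :=
          mul_le_mul_of_nonneg_left key (abs_nonneg _)
      _ = _ := by ring

theorem IsDivisorWeight.summable_mulExt_coeffTerm (hw : IsDivisorWeight k w) (hk : 1 ≤ k)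
    {s : Fin r → ℝ} {δ : ℝ} (hδ : 0 < δ) (hs : ∀ j, 0 < s j)
    (hs2 : ∀ i j, i ≠ j → 1 + δ ≤ s i + s j) : Summable (mulExt (coeffTerm k w s)) := by
  have hsum : ∀ p, p.Prime → Summable (coeffTerm k w s p) := fun p hp =>
    (hw.hasSum_coeffTerm hs hp).summable
  have ha : Summable fun p : ℕ => (p : ℝ) ^ (-(1 + δ)) :=
    Real.summable_nat_rpow.mpr (by linarith)
  refine summable_mulExt (fun p => hw.coeffTerm_zero hk s p) hsum
    (ha.mul_left (2 ^ (1 + δ) * ∑' ν, |coeffTerm k w s 2 ν|)) (fun p => ?_) fun p hp => ?_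
  · have : 0 ≤ ∑' ν, |coeffTerm k w s 2 ν| := tsum_nonneg fun ν => abs_nonneg _
    positivity
  · have h2 := (((hsum 2 Nat.prime_two).abs.hasSum.mul_left (2 ^ (1 + δ))).mul_right
      ((p : ℝ) ^ (-(1 + δ))))
    have h3 := (hasSum_ite_eq (0 : Fin r → ℕ) (1 : ℝ)).add h2
    exact hasSum_le (hw.abs_coeffTerm_le hk hs hs2 hp) (hsum p hp).abs.hasSum h3

theorem mulExt_prod_rpow (s : Fin r → ℝ) {d : Fin r → ℕ} (hd : ∀ j, d j ≠ 0) :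
    mulExt (fun p ν => ∏ j, ((p : ℝ) ^ (-s j)) ^ ν j) d = ∏ j, (d j : ℝ) ^ (-s j) := by
  rw [mulExt_eq_prod (by simp) hd (P := (∏ j, d j).primeFactors) fun j =>
    Nat.primeFactors_mono (Finset.dvd_prod_of_mem d (Finset.mem_univ j))
      (Finset.prod_ne_zero_iff.mpr fun j _ => hd j), Finset.prod_comm]
  refine Finset.prod_congr rfl fun j _ => ?_
  have h0 : ∏ j, d j ≠ 0 := Finset.prod_ne_zero_iff.mpr fun j _ => hd j
  have h1 : ∏ p ∈ (∏ j, d j).primeFactors, p ^ (d j).factorization p = d j := by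
    conv_rhs => rw [← Nat.prod_factorization_pow_eq_self (hd j)]
    exact (Finset.prod_subset
      (Nat.primeFactors_mono (Finset.dvd_prod_of_mem d (Finset.mem_univ j)) h0) fun p _ hp => by
        rw [Finsupp.notMem_support_iff.mp hp, pow_zero]).symm
  conv_rhs => rw [← h1, Nat.cast_prod]
  rw [← Real.finsetProd_rpow _ _ fun p _ => Nat.cast_nonneg _]
  refine Finset.prod_congr rfl fun p _ => ?_
  rw [Nat.cast_pow, Real.rpow_pow_comm (Nat.cast_nonneg p)]
  rfl

/-- The multiplicative function of several variables with local coefficients `localCoeff k w`. -/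
noncomputable def corrector (k : ℕ) (w : (Fin r → ℕ) → ℕ) : (Fin r → ℕ) → ℝ :=
  mulExt fun _ => localCoeff k w

theorem mulExt_coeffTerm (s : Fin r → ℝ) (d : Fin r → ℕ) :
    mulExt (coeffTerm k w s) d = corrector k w d * ∏ j, (d j : ℝ) ^ (-s j) := by
  have h := mulExt_mul (fun _ => localCoeff k w)
    (fun p ν => ∏ j, ((p : ℝ) ^ (-s j)) ^ ν j) d
  by_cases hd : ∀ j, d j ≠ 0
  · rw [mulExt_prod_rpow s hd] at h
    exact h
  · push Not at hd
    obtain ⟨j, hj⟩ := hd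
    rw [corrector, mulExt_of_eq_zero _ hj, mulExt_of_eq_zero _ hj, zero_mul]

theorem IsDivisorWeight.summable_corrector (hw : IsDivisorWeight k w) (hk : 1 ≤ k)
    {s : Fin r → ℝ} {δ : ℝ} (hδ : 0 < δ) (hs : ∀ j, 0 < s j)
    (hs2 : ∀ i j, i ≠ j → 1 + δ ≤ s i + s j) :
    Summable fun d : Fin r → ℕ => corrector k w d * ∏ j, (d j : ℝ) ^ (-s j) :=
  (hw.summable_mulExt_coeffTerm hk hδ hs hs2).congr fun d => mulExt_coeffTerm s d

theorem IsDivisorWeight.hasProd_secondFactor (hw : IsDivisorWeight k w) (hk : 1 ≤ k)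
    {s : Fin r → ℝ} {δ : ℝ} (hδ : 0 < δ) (hs : ∀ j, 0 < s j)
    (hs2 : ∀ i j, i ≠ j → 1 + δ ≤ s i + s j) :
    HasProd (fun p : Nat.Primes => secondFactor k w s p)
      (∑' d : Fin r → ℕ, corrector k w d * ∏ j, (d j : ℝ) ^ (-s j)) := by
  have h := hasProd_mulExt (fun p => hw.coeffTerm_zero hk s p)
    (fun p hp => (hw.hasSum_coeffTerm hs hp).summable)
    (hw.summable_mulExt_coeffTerm hk hδ hs hs2)
  simp_rw [mulExt_coeffTerm] at h
  exact h.congr_fun fun p => (hw.hasSum_coeffTerm hs p.2).tsum_eq.symm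

/-- Symmetry of the weight makes the r first-order terms share one Euler product, whence the factor
r in the second constant. -/
theorem IsDivisorWeight.secondFactor_comp_perm (hw : IsDivisorWeight k w)
    (σ : Equiv.Perm (Fin r)) (s : Fin r → ℝ) (p : ℕ) :
    secondFactor k w (s ∘ σ) p = secondFactor k w s p := by
  rw [secondFactor, secondFactor]
  congr 1
  · exact Equiv.prod_comp σ fun j => (1 - (p : ℝ) ^ (-s j)) * (1 - (p : ℝ) ^ (-((k : ℝ) * s j)))
  · rw [← (Equiv.arrowCongr σ (Equiv.refl ℕ)).tsum_eq (localTerm w s p)]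
    refine tsum_congr fun ν => ?_
    have h1 : (Equiv.arrowCongr σ (Equiv.refl ℕ)) ν = ν ∘ σ.symm := rfl
    rw [h1, localTerm, localTerm, hw.symm]
    congr 2
    rw [← Equiv.sum_comp σ fun j => ((ν ∘ σ.symm) j : ℝ) * s j]
    simp

end DivisorAverages

/-! ### The function τ and elementary bounds for its summatory function. -/

namespace DivisorAverages

/-- A pair (a, b) is determined by b, and b^k ∣ n exactly when b divides `Nat.floorRoot k n`. -/
theorem tau_eq_card_divisors {k n : ℕ} (hk : k ≠ 0) (hn : n ≠ 0) :
    tau k n = (Nat.floorRoot k n).divisors.card := by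
  rw [tau]
  have h0 : Nat.floorRoot k n ≠ 0 := Nat.floorRoot_ne_zero.mpr ⟨hk, hn⟩
  refine Finset.card_bij' (fun a _ => a.2) (fun b _ => (n / b ^ k, b)) ?_ ?_ ?_ ?_
  · rintro ⟨a, b⟩ h
    obtain ⟨-, rfl⟩ := Finset.mem_filter.mp h
    exact Nat.mem_divisors.mpr
      ⟨Nat.pow_dvd_iff_dvd_floorRoot.mp (Dvd.intro_left _ rfl), h0⟩
  · intro b hb
    have h1 := Nat.pow_dvd_iff_dvd_floorRoot.mpr (Nat.mem_divisors.mp hb).1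
    refine Finset.mem_filter.mpr ⟨Finset.mem_product.mpr ⟨?_, ?_⟩, Nat.div_mul_cancel h1⟩
    · exact Nat.mem_divisors.mpr ⟨Nat.div_dvd_of_dvd h1, hn⟩
    · exact Nat.mem_divisors.mpr ⟨(dvd_pow_self b hk).trans h1, hn⟩
  · rintro ⟨a, b⟩ h
    obtain ⟨-, h⟩ := Finset.mem_filter.mp h
    simp only at h
    have hb : b ^ k ≠ 0 := fun hb => hn (by rw [← h, hb, mul_zero])
    rw [← h, Nat.mul_div_cancel _ (Nat.pos_of_ne_zero hb)]
  · intro b _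
    rfl

theorem tau_eq_prod {k n : ℕ} (hk : k ≠ 0) (hn : n ≠ 0) {P : Finset ℕ}
    (hP : n.primeFactors ⊆ P) : tau k n = ∏ p ∈ P, (n.factorization p / k + 1) := by
  have h0 : Nat.floorRoot k n ≠ 0 := Nat.floorRoot_ne_zero.mpr ⟨hk, hn⟩
  have hfac : ∀ p, (Nat.floorRoot k n).factorization p = n.factorization p / k := fun p => by
    rw [Nat.factorization_floorRoot]; rfl
  rw [tau_eq_card_divisors hk hn, Nat.card_divisors h0]
  simp_rw [hfac]
  refine Finset.prod_subset (fun p hp => hP ?_) fun p _ hp => ?_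
  · rw [← Nat.support_factorization] at hp ⊢
    refine Finsupp.mem_support_iff.mpr fun h => Finsupp.mem_support_iff.mp hp ?_
    rw [hfac, h, Nat.zero_div]
  · rw [← hfac, Finsupp.notMem_support_iff.mp hp, zero_add]

theorem tau_prod_eq_mulExt {r k : ℕ} (hk : k ≠ 0) {n : Fin r → ℕ} (hn : ∀ j, n j ≠ 0) :
    (tau k (∏ j, n j) : ℝ) = mulExt (fun _ ν => (prodWeight r k ν : ℝ)) n := by
  have h0 : ∏ j, n j ≠ 0 := Finset.prod_ne_zero_iff.mpr fun j _ => hn j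
  rw [mulExt, if_neg h0, tau_eq_prod hk h0 subset_rfl, Nat.cast_prod]
  refine Finset.prod_congr rfl fun p _ => ?_
  rw [Nat.factorization_prod fun j _ => hn j, Finsupp.finsetSum_apply]
  rfl

theorem tau_lcm_eq_mulExt {r k : ℕ} (hk : k ≠ 0) {n : Fin r → ℕ} (hn : ∀ j, n j ≠ 0) :
    (tau k (Finset.univ.lcm n) : ℝ) = mulExt (fun _ ν => (lcmWeight r k ν : ℝ)) n := by
  have h0 : ∏ j, n j ≠ 0 := Finset.prod_ne_zero_iff.mpr fun j _ => hn j
  have h1 : Finset.univ.lcm n ≠ 0 := fun h => by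
    obtain ⟨j, -, hj⟩ := Finset.lcm_eq_zero_iff.mp h
    exact hn j hj
  have h2 : Finset.univ.lcm n ∣ ∏ j, n j :=
    Finset.lcm_dvd fun j hj => Finset.dvd_prod_of_mem n hj
  rw [mulExt, if_neg h0, tau_eq_prod hk h1 (Nat.primeFactors_mono h2 h0), Nat.cast_prod]
  refine Finset.prod_congr rfl fun p _ => ?_
  rw [Finset.factorization_lcm fun j _ => hn j]
  rfl

theorem prod_tau_eq_mulExt {r k : ℕ} (hk : k ≠ 0) {n : Fin r → ℕ} (hn : ∀ j, n j ≠ 0) :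
    ∏ j, (tau k (n j) : ℝ) = mulExt (fun _ ν => ∏ j, ((ν j / k + 1 : ℕ) : ℝ)) n := by
  have h0 : ∏ j, n j ≠ 0 := Finset.prod_ne_zero_iff.mpr fun j _ => hn j
  rw [mulExt, if_neg h0, Finset.prod_comm]
  refine Finset.prod_congr rfl fun j _ => ?_
  rw [tau_eq_prod hk (hn j)
    (Nat.primeFactors_mono (Finset.dvd_prod_of_mem n (Finset.mem_univ j)) h0), Nat.cast_prod]
  rfl

/-- The summatory function of `τ_{1,k}`. -/
noncomputable def tauSum (k : ℕ) (x : ℝ) : ℝ := ∑ n ∈ Finset.Icc 1 ⌊x⌋₊, (tau k n : ℝ)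

theorem sum_box_eq {r k : ℕ} {w : (Fin r → ℕ) → ℕ} (hw : IsDivisorWeight k w) (hk : 1 ≤ k)
    {f : (Fin r → ℕ) → ℝ}
    (hf : ∀ n : Fin r → ℕ, (∀ j, n j ≠ 0) → f n = mulExt (fun _ ν => (w ν : ℝ)) n) (x : ℝ) :
    ∑ n ∈ box r x, f n = ∑ d ∈ box r x, corrector k w d * ∏ j, tauSum k (x / d j) := by
  rw [sum_box_convolution f (corrector k w)
    (mulExt fun _ ν => ∏ j, ((ν j / k + 1 : ℕ) : ℝ)) fun n hn => by
      rw [hf n hn]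
      exact mulExt_convolution (by simp [hw.apply_zero]) (hw.localCoeff_zero hk) (by simp)
        (convCoeff_convolution hk _) hn]
  refine Finset.sum_congr rfl fun d _ => ?_
  congr 1
  simp_rw [tauSum]
  rw [Finset.prod_univ_sum]
  refine Finset.sum_congr rfl fun m hm => (prod_tau_eq_mulExt (by omega) fun j => ?_).symm
  have := Fintype.mem_piFinset.mp hm j
  rw [Finset.mem_Icc] at this
  omega

theorem tauSum_of_lt_one (k : ℕ) {x : ℝ} (hx : x < 1) : tauSum k x = 0 := by
  simp [tauSum, Nat.floor_eq_zero.mpr hx]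

theorem tauSum_eq_sum_div {k : ℕ} (hk : k ≠ 0) (x : ℝ) :
    tauSum k x = ∑ b ∈ Finset.Icc 1 ⌊x⌋₊, ((⌊x⌋₊ / b ^ k : ℕ) : ℝ) := by
  rw [tauSum, ← Nat.cast_sum, ← Nat.cast_sum]
  congr 1
  have h1 : ∀ n ∈ Finset.Icc 1 ⌊x⌋₊,
      tau k n = ∑ b ∈ Finset.Icc 1 ⌊x⌋₊, if b ^ k ∣ n then 1 else 0 := fun n hn => by
    obtain ⟨hn1, hn2⟩ := Finset.mem_Icc.mp hn
    rw [tau_eq_card_divisors hk (by omega), ← Finset.card_filter]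
    congr 1
    ext b
    rw [Nat.mem_divisors, Finset.mem_filter, Finset.mem_Icc, Nat.pow_dvd_iff_dvd_floorRoot]
    constructor
    · rintro ⟨h, h0⟩
      have h2 := Nat.pow_dvd_iff_dvd_floorRoot.mpr h
      have h3 := (dvd_pow_self b hk).trans h2
      exact ⟨⟨Nat.pos_of_dvd_of_pos h3 hn1, (Nat.le_of_dvd hn1 h3).trans hn2⟩, h⟩
    · rintro ⟨-, h⟩
      exact ⟨h, Nat.floorRoot_ne_zero.mpr ⟨hk, by omega⟩⟩
  rw [Finset.sum_congr rfl h1, Finset.sum_comm]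
  refine Finset.sum_congr rfl fun b _ => ?_
  rw [← Finset.card_filter]
  exact Nat.Ioc_filter_dvd_card_eq_div ⌊x⌋₊ (b ^ k)

theorem zetaR_natCast {k : ℕ} (hk : 1 < k) : zetaR k = ∑' n : ℕ, 1 / (n : ℝ) ^ k := by
  have h : riemannZeta ((k : ℝ) : ℂ) = ((∑' n : ℕ, 1 / (n : ℝ) ^ k : ℝ) : ℂ) := by
    rw [Complex.ofReal_natCast, zeta_nat_eq_tsum_of_gt_one hk, Complex.ofReal_tsum]
    push_cast
    rfl
  rw [zetaR, h, Complex.ofReal_re]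

theorem sum_Icc_le_zetaR {k : ℕ} (hk : 1 < k) (N : ℕ) :
    ∑ b ∈ Finset.Icc 1 N, 1 / (b : ℝ) ^ k ≤ zetaR k := by
  rw [zetaR_natCast hk]
  exact (Real.summable_one_div_nat_pow.mpr hk).sum_le_tsum _ fun _ _ => by positivity

theorem zetaR_natCast_pos {k : ℕ} (hk : 1 < k) : 0 < zetaR k := by
  have := sum_Icc_le_zetaR hk 1
  simp at this
  linarith

/-- For b > B, b^(-k) ≤ (B+1)^(-(k-2)) b^(-2), and the tail of ∑ b^(-2) is at most 2/(B+1). -/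
theorem zetaR_le_sum_add {k : ℕ} (hk : 2 ≤ k) (B : ℕ) :
    zetaR k ≤ ∑ b ∈ Finset.Icc 1 B, 1 / (b : ℝ) ^ k + 2 / ((B : ℝ) + 1) ^ (k - 1) := by
  rw [zetaR_natCast (by omega)]
  refine Real.tsum_le_of_sum_range_le (fun n => by positivity) fun n => ?_
  have h1 : ∑ b ∈ Finset.Ioo B n, 1 / (b : ℝ) ^ k ≤ 2 / ((B : ℝ) + 1) ^ (k - 1) := by
    have hpos : (0 : ℝ) < (B : ℝ) + 1 := by positivity
    calc ∑ b ∈ Finset.Ioo B n, 1 / (b : ℝ) ^ k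
        ≤ ∑ b ∈ Finset.Ioo B n, 1 / ((B : ℝ) + 1) ^ (k - 2) * ((b : ℝ) ^ 2)⁻¹ := by
          refine Finset.sum_le_sum fun b hb => ?_
          have hb' : (B : ℝ) + 1 ≤ b := by exact_mod_cast (Finset.mem_Ioo.mp hb).1
          have hb0 : (0 : ℝ) < b := hpos.trans_le hb'
          rw [show (b : ℝ) ^ k = (b : ℝ) ^ (k - 2) * (b : ℝ) ^ 2 by
            rw [← pow_add]; congr 1; omega, ← one_div, one_div_mul_one_div]
          gcongr
      _ = 1 / ((B : ℝ) + 1) ^ (k - 2) * ∑ b ∈ Finset.Ioo B n, ((b : ℝ) ^ 2)⁻¹ :=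
          (Finset.mul_sum _ _ _).symm
      _ ≤ 1 / ((B : ℝ) + 1) ^ (k - 2) * (2 / ((B : ℝ) + 1)) := by
          gcongr
          exact sum_Ioo_inv_sq_le B n
      _ = 2 / ((B : ℝ) + 1) ^ (k - 1) := by
          rw [show k - 1 = (k - 2) + 1 by omega, pow_succ]
          field_simp
  have h2 : Finset.range n ⊆ insert 0 (Finset.Icc 1 B ∪ Finset.Ioo B n) := fun b hb => by
    simp only [Finset.mem_range, Finset.mem_insert, Finset.mem_union, Finset.mem_Icc,
      Finset.mem_Ioo] at hb ⊢
    omega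
  have h3 : Disjoint (Finset.Icc 1 B) (Finset.Ioo B n) :=
    Finset.disjoint_left.mpr fun b hb hb' => by
      simp only [Finset.mem_Icc, Finset.mem_Ioo] at hb hb'
      omega
  refine (Finset.sum_le_sum_of_subset_of_nonneg h2 fun b _ _ => by positivity).trans ?_
  rw [Finset.sum_insert (by simp), Finset.sum_union h3]
  simp only [Nat.cast_zero, zero_pow (by omega : k ≠ 0), div_zero, zero_add]
  linarith

/-- T(x) = ∑_b ⌊x/b^k⌋ is at most ζ(k)x. For the lower bound keep only b ≤ y = x^(1/k): removing the
floors costs at most y and the tail of ζ(k)x at most 2y, whence the constant 3. -/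
theorem abs_tauSum_sub_le {k : ℕ} (hk : 2 ≤ k) {x : ℝ} (hx : 1 ≤ x) :
    |tauSum k x - zetaR k * x| ≤ 3 * x ^ (1 / (k : ℝ)) := by
  have hx0 : 0 ≤ x := zero_le_one.trans hx
  set y := x ^ (1 / (k : ℝ)) with hy
  have hyk : y ^ k = x := by
    rw [hy, one_div, Real.rpow_inv_natCast_pow hx0 (by omega)]
  have hy1 : 1 ≤ y := Real.one_le_rpow hx (by positivity)
  have hyx : y ≤ x := hyk ▸ le_self_pow₀ hy1 (by omega)
  set B := ⌊y⌋₊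
  have hBy : (B : ℝ) ≤ y := Nat.floor_le (by linarith)
  have hyB : y < B + 1 := Nat.lt_floor_add_one y
  have hBN : B ≤ ⌊x⌋₊ := Nat.floor_mono hyx
  have hT := tauSum_eq_sum_div (k := k) (by omega) x
  have hfl : ∀ b : ℕ, ((⌊x⌋₊ / b ^ k : ℕ) : ℝ) = (⌊x / (b : ℝ) ^ k⌋₊ : ℝ) := fun b => by
    rw [← Nat.cast_pow, Nat.floor_div_natCast]
  simp_rw [hfl] at hT
  have hup : tauSum k x ≤ zetaR k * x := by
    calc tauSum k x ≤ ∑ b ∈ Finset.Icc 1 ⌊x⌋₊, 1 / (b : ℝ) ^ k * x := by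
          rw [hT]
          refine Finset.sum_le_sum fun b _ => (Nat.floor_le (by positivity)).trans_eq ?_
          ring
      _ = (∑ b ∈ Finset.Icc 1 ⌊x⌋₊, 1 / (b : ℝ) ^ k) * x := (Finset.sum_mul _ _ _).symm
      _ ≤ _ := mul_le_mul_of_nonneg_right (sum_Icc_le_zetaR (by omega) _) hx0
  have hlow : (∑ b ∈ Finset.Icc 1 B, 1 / (b : ℝ) ^ k) * x - y ≤ tauSum k x := by
    calc (∑ b ∈ Finset.Icc 1 B, 1 / (b : ℝ) ^ k) * x - y
        ≤ ∑ b ∈ Finset.Icc 1 B, (1 / (b : ℝ) ^ k * x - 1) := by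
          rw [Finset.sum_sub_distrib, Finset.sum_mul]
          simp only [Finset.sum_const, Nat.card_Icc, Nat.add_sub_cancel, nsmul_eq_mul, mul_one]
          linarith
      _ ≤ ∑ b ∈ Finset.Icc 1 B, (⌊x / (b : ℝ) ^ k⌋₊ : ℝ) := by
          refine Finset.sum_le_sum fun b _ => ?_
          have := Nat.lt_floor_add_one (x / (b : ℝ) ^ k)
          rw [one_div_mul_eq_div]
          linarith
      _ ≤ _ := by
          rw [hT]
          exact Finset.sum_le_sum_of_subset_of_nonneg (Finset.Icc_subset_Icc_right hBN)
            fun _ _ _ => Nat.cast_nonneg _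
  have htail : 2 / ((B : ℝ) + 1) ^ (k - 1) * x ≤ 2 * y := by
    rw [div_mul_eq_mul_div, div_le_iff₀ (by positivity)]
    calc 2 * x = 2 * y * y ^ (k - 1) := by
          rw [← hyk, mul_assoc, ← pow_succ']
          congr 2
          omega
      _ ≤ _ := by gcongr
  have hz := mul_le_mul_of_nonneg_right (zetaR_le_sum_add hk B) hx0
  rw [add_mul] at hz
  rw [abs_le]
  constructor <;> linarith

/-- The range x < 1 is included, where T = 0 and x ≤ x^β, because x / d_j becomes small when d runs
over all tuples. -/
theorem abs_tauSum_sub_le_rpow {k : ℕ} (hk : 2 ≤ k) {x β : ℝ} (hx : 0 < x)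
    (hβ : 1 / (k : ℝ) ≤ β) (hβ1 : β ≤ 1) :
    |tauSum k x - zetaR k * x| ≤ (3 + zetaR k) * x ^ β := by
  have hz := zetaR_natCast_pos (k := k) (by omega)
  have hxβ := Real.rpow_pos_of_pos hx β
  rcases le_or_gt 1 x with h | h
  · have h1 := abs_tauSum_sub_le hk h
    have h2 := Real.rpow_le_rpow_of_exponent_le h hβ
    nlinarith [mul_pos hz hxβ]
  · rw [tauSum_of_lt_one k h, zero_sub, abs_neg, abs_of_pos (mul_pos hz hx)]
    have h2 := Real.rpow_le_rpow_of_exponent_ge hx h.le hβ1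
    rw [Real.rpow_one] at h2
    nlinarith

end DivisorAverages

/-! ### The one-variable error term and the least admissible exponent. -/

namespace DivisorAverages

theorem oneVarError_eq (k : ℕ) (x : ℝ) : oneVarError k x =
    tauSum k x - zetaR k * x - zetaR (1 / (k : ℝ)) * x ^ (1 / (k : ℝ)) :=
  sub_add_eq_sub_sub _ _ _

theorem one_div_natCast_le_one {k : ℕ} (hk : 2 ≤ k) : 1 / (k : ℝ) ≤ 1 / 2 :=
  one_div_le_one_div_of_le two_pos (by exact_mod_cast hk)

theorem abs_oneVarError_le {k : ℕ} (hk : 2 ≤ k) {x : ℝ} (hx : 0 < x) :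
    |oneVarError k x| ≤ (3 + zetaR k + |zetaR (1 / (k : ℝ))|) * x ^ (1 / (k : ℝ)) := by
  rw [oneVarError_eq, add_mul]
  refine (abs_sub _ _).trans (add_le_add (abs_tauSum_sub_le_rpow hk hx le_rfl ?_) ?_)
  · linarith [one_div_natCast_le_one hk]
  · rw [abs_mul, abs_of_pos (Real.rpow_pos_of_pos hx _)]

theorem rpow_isBigO_rpow {a b : ℝ} (h : a ≤ b) :
    (fun x : ℝ => x ^ a) =O[atTop] fun x : ℝ => x ^ b := by
  refine IsBigO.of_bound 1 ?_
  filter_upwards [eventually_ge_atTop 1] with x hx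
  have hx0 : 0 ≤ x := zero_le_one.trans hx
  rw [one_mul, Real.norm_of_nonneg (Real.rpow_nonneg hx0 _),
    Real.norm_of_nonneg (Real.rpow_nonneg hx0 _)]
  exact Real.rpow_le_rpow_of_exponent_le hx h

theorem oneVarError_isBigO {k : ℕ} (hk : 2 ≤ k) :
    oneVarError k =O[atTop] fun x : ℝ => x ^ (1 / (k : ℝ)) := by
  refine IsBigO.of_bound (3 + zetaR k + |zetaR (1 / (k : ℝ))|) ?_
  filter_upwards [eventually_gt_atTop 0] with x hx
  rw [Real.norm_of_nonneg (Real.rpow_nonneg hx.le _)]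
  exact abs_oneVarError_le hk hx

theorem one_div_mem_admissibleExponents {k : ℕ} (hk : 2 ≤ k) :
    1 / (k : ℝ) ∈ admissibleExponents k := fun _ hε =>
  (oneVarError_isBigO hk).trans (rpow_isBigO_rpow (by linarith))

theorem one_le_tau {k n : ℕ} (hk : k ≠ 0) (hn : n ≠ 0) : 1 ≤ tau k n := by
  rw [tau_eq_card_divisors hk hn]
  exact Finset.card_pos.mpr (Nat.nonempty_divisors.mpr (Nat.floorRoot_ne_zero.mpr ⟨hk, hn⟩))

/-- The jumps of the error term at integers exclude negative exponents. -/
theorem nonneg_of_mem_admissibleExponents {k : ℕ} (hk : 2 ≤ k) {θ : ℝ}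
    (hθ : θ ∈ admissibleExponents k) : 0 ≤ θ := by
  by_contra! hneg
  have h0 : Tendsto (oneVarError k) atTop (nhds 0) := by
    refine (hθ (-θ / 2) (by linarith)).trans_tendsto ?_
    have := tendsto_rpow_neg_atTop (y := -θ / 2) (by linarith)
    refine this.congr fun x => ?_
    congr 1
    ring
  obtain ⟨X, hX⟩ := eventually_atTop.mp (Metric.tendsto_nhds.mp h0 (1 / 4) (by norm_num))
  set N : ℕ := ⌈X⌉₊ + 1
  have hN : X + 1 ≤ N := by
    have := Nat.le_ceil X
    push_cast [N]
    linarith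
  have hN1 : (1 : ℝ) ≤ N := by simp [N]
  let g : ℝ → ℝ := fun x => zetaR k * x + zetaR (1 / (k : ℝ)) * x ^ (1 / (k : ℝ))
  have hg : ContinuousAt g N :=
    (continuousAt_const.mul continuousAt_id).add (continuousAt_const.mul
      (Real.continuousAt_rpow_const _ _ (Or.inl (by linarith))))
  obtain ⟨δ, hδ, hδg⟩ := Metric.continuousAt_iff.mp hg (1 / 4) (by norm_num)
  -- Just left of the integer N, with y > X since N ≥ X + 1. Between y and N, T jumps by τ(N) ≥ 1,
  -- while both errors and the change of the smooth part `g` are each below 1/4, a contradiction.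
  set y : ℝ := N - min (δ / 2) (1 / 2) with hy
  have hm0 : 0 < min (δ / 2) (1 / 2) := lt_min (by linarith) (by norm_num)
  have hm1 : min (δ / 2) (1 / 2) ≤ δ / 2 := min_le_left _ _
  have hm2 : min (δ / 2) (1 / 2) ≤ 1 / 2 := min_le_right _ _
  have hfloor : ⌊y⌋₊ = ⌈X⌉₊ := by
    rw [Nat.floor_eq_iff (by linarith)]
    have : (N : ℝ) = ⌈X⌉₊ + 1 := by push_cast [N]; rfl
    constructor <;> linarith
  have e1 : oneVarError k N = tauSum k y + tau k N - g N := by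
    simp only [oneVarError, g, tauSum, hfloor, Nat.floor_natCast]
    rw [Finset.sum_Icc_succ_top (by omega)]
  have e2 : oneVarError k y = tauSum k y - g y := rfl
  have h1 := hX N (by linarith)
  have h2 := hX y (by linarith)
  have h3 := @hδg y (by
    rw [Real.dist_eq, abs_sub_comm, abs_of_nonneg (by linarith)]
    linarith)
  have h4 : (1 : ℝ) ≤ tau k N := by exact_mod_cast one_le_tau (by omega) (by omega)
  rw [Real.dist_eq, sub_zero, e1, abs_lt] at h1
  rw [Real.dist_eq, sub_zero, e2, abs_lt] at h2
  rw [Real.dist_eq, abs_lt] at h3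
  linarith [h1.1, h1.2, h2.1, h2.2, h3.1, h3.2]

theorem isLeast_theta {k : ℕ} (hk : 2 ≤ k) : IsLeast (admissibleExponents k) (theta k) := by
  have hne : (admissibleExponents k).Nonempty := ⟨_, one_div_mem_admissibleExponents hk⟩
  have hbdd : BddBelow (admissibleExponents k) :=
    ⟨0, fun _ h => nonneg_of_mem_admissibleExponents hk h⟩
  refine ⟨fun ε hε => ?_, fun θ hθ => csInf_le hbdd hθ⟩
  obtain ⟨θ, hθ, hlt⟩ := exists_lt_of_csInf_lt hne
    (show sInf (admissibleExponents k) < theta k + ε / 2 by rw [← theta]; linarith)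
  exact (hθ (ε / 2) (by linarith)).trans (rpow_isBigO_rpow (by linarith))

/-- On a bounded range 0 < x < X the elementary bound x^(1/k) is at most a constant times x^θ,
precisely because θ ≤ 1/k. -/
theorem exists_abs_oneVarError_le {k : ℕ} (hk : 2 ≤ k) {θ : ℝ} (hθ : θ ≤ 1 / (k : ℝ))
    (h : oneVarError k =O[atTop] fun x : ℝ => x ^ θ) :
    ∃ C : ℝ, 0 ≤ C ∧ ∀ x : ℝ, 0 < x → |oneVarError k x| ≤ C * x ^ θ := by
  obtain ⟨c, hc, hcb⟩ := h.exists_pos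
  obtain ⟨X, hX⟩ := eventually_atTop.mp hcb.bound
  set A := 3 + zetaR k + |zetaR (1 / (k : ℝ))|
  have hA : 0 ≤ A := by
    have := zetaR_natCast_pos (k := k) (by omega)
    positivity
  set Y := max X 1
  have hY : 0 < Y := lt_max_of_lt_right one_pos
  refine ⟨c + A * Y ^ (1 / (k : ℝ) - θ), by positivity, fun x hx => ?_⟩
  have hxθ := Real.rpow_pos_of_pos hx θ
  rw [add_mul]
  rcases le_or_gt X x with hXx | hXx
  · have := hX x hXx
    rw [Real.norm_of_nonneg hxθ.le] at this
    exact this.trans (le_add_of_nonneg_right (by positivity))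
  · refine (abs_oneVarError_le hk hx).trans (le_trans ?_ (le_add_of_nonneg_left (by positivity)))
    rw [mul_assoc]
    refine mul_le_mul_of_nonneg_left ?_ hA
    calc x ^ (1 / (k : ℝ)) = x ^ (1 / (k : ℝ) - θ) * x ^ θ := by
          rw [← Real.rpow_add hx]; congr 1; ring
      _ ≤ _ := by
          gcongr
          exact hXx.le.trans (le_max_left _ _)

end DivisorAverages

/-! ### Expansion of ∏ T(x / d_j) and summation against h. -/

namespace DivisorAverages

section Expansion

variable {ι : Type*} [DecidableEq ι] {z K : ℝ} {ρ η : ι → ℝ}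

theorem abs_prod_add_sub_pow_le (hK : 1 ≤ K) (hz : |z| ≤ K) (hρ : ∀ j, |ρ j| ≤ K)
    (hρη : ∀ j, |ρ j| ≤ K * η j) (hη : ∀ j, 0 ≤ η j) (s : Finset ι) :
    |∏ j ∈ s, (z + ρ j) - z ^ s.card| ≤ (2 * K) ^ s.card * ∑ j ∈ s, η j := by
  induction s using Finset.induction_on with
  | empty => simp
  | insert a s ha ih =>
    rw [Finset.prod_insert ha, Finset.card_insert_of_notMem ha, Finset.sum_insert ha]
    have hza : |z + ρ a| ≤ 2 * K := (abs_add_le _ _).trans (by linarith [hρ a])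
    have hp1 : |z| ^ s.card ≤ (2 * K) ^ s.card :=
      pow_le_pow_left₀ (abs_nonneg z) (by linarith) _
    have hp0 : 0 ≤ (2 * K) ^ s.card := by positivity
    calc |(z + ρ a) * ∏ j ∈ s, (z + ρ j) - z ^ (s.card + 1)|
        = |(z + ρ a) * (∏ j ∈ s, (z + ρ j) - z ^ s.card) + ρ a * z ^ s.card| := by
          congr 1; ring
      _ ≤ |z + ρ a| * |∏ j ∈ s, (z + ρ j) - z ^ s.card| + |ρ a| * |z| ^ s.card := by
          rw [← abs_mul, ← abs_pow, ← abs_mul]; exact abs_add_le _ _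
      _ ≤ 2 * K * ((2 * K) ^ s.card * ∑ j ∈ s, η j) + K * η a * (2 * K) ^ s.card := by
          have := hη a
          gcongr
          exact hρη a
      _ ≤ _ := by
          rw [pow_succ]
          nlinarith [mul_nonneg (mul_nonneg hp0 (hη a)) (zero_le_one.trans hK)]

/-- Every term of order at least two contains some ρ_i ρ_j with i ≠ j, which is charged to η_i η_j;
the other factors are bounded. No square η_i² appears, so only exponent pairs at distinct
coordinates arise later. -/
theorem abs_prod_add_sub_pow_sub_le (hK : 1 ≤ K) (hz : |z| ≤ K) (hρ : ∀ j, |ρ j| ≤ K)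
    (hρη : ∀ j, |ρ j| ≤ K * η j) (hη : ∀ j, 0 ≤ η j) (s : Finset ι) :
    |∏ j ∈ s, (z + ρ j) - z ^ s.card - z ^ (s.card - 1) * ∑ j ∈ s, ρ j| ≤
      (2 * K) ^ s.card * ∑ i ∈ s, ∑ j ∈ s, if i = j then 0 else η i * η j := by
  induction s using Finset.induction_on with
  | empty => simp
  | insert a s ha ih =>
    have hQ := abs_prod_add_sub_pow_le hK hz hρ hρη hη s
    rw [Finset.prod_insert ha, Finset.card_insert_of_notMem ha, Finset.sum_insert ha]
    have hp0 : 0 ≤ (2 * K) ^ s.card := by positivity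
    -- For empty `s` the truncated subtraction is harmless because the sum is zero.
    have hzz : z * (z ^ (s.card - 1) * ∑ j ∈ s, ρ j) = z ^ s.card * ∑ j ∈ s, ρ j := by
      rcases s.eq_empty_or_nonempty with rfl | hs
      · simp
      · rw [← mul_assoc, mul_pow_sub_one hs.card_pos.ne']
    have hterm : ∀ i j, 0 ≤ if i = j then 0 else η i * η j := fun i j => by
      split_ifs
      · rfl
      · exact mul_nonneg (hη i) (hη j)
    set E := ∑ i ∈ s, ∑ j ∈ s, if i = j then 0 else η i * η j
    have hE : E + η a * ∑ j ∈ s, η j ≤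
        ∑ i ∈ insert a s, ∑ j ∈ insert a s, if i = j then 0 else η i * η j := by
      rw [Finset.sum_insert ha, add_comm]
      refine add_le_add ?_ (Finset.sum_le_sum fun i _ =>
        Finset.sum_le_sum_of_subset_of_nonneg (Finset.subset_insert _ _) fun j _ _ => hterm i j)
      rw [Finset.mul_sum, Finset.sum_insert ha, if_pos rfl, zero_add]
      refine Finset.sum_le_sum fun j hj => ?_
      rw [if_neg fun h : a = j => ha (h ▸ hj)]
    have hE0 : 0 ≤ E := Finset.sum_nonneg fun i _ => Finset.sum_nonneg fun j _ => hterm i j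
    have hη0 : 0 ≤ ∑ j ∈ s, η j := Finset.sum_nonneg fun j _ => hη j
    calc |(z + ρ a) * ∏ j ∈ s, (z + ρ j) - z ^ (s.card + 1)
          - z ^ (s.card + 1 - 1) * (ρ a + ∑ j ∈ s, ρ j)|
        = |z * (∏ j ∈ s, (z + ρ j) - z ^ s.card - z ^ (s.card - 1) * ∑ j ∈ s, ρ j)
            + ρ a * (∏ j ∈ s, (z + ρ j) - z ^ s.card)| := by
          rw [mul_sub z, hzz, Nat.add_sub_cancel]
          congr 1; ring
      _ ≤ |z| * |∏ j ∈ s, (z + ρ j) - z ^ s.card - z ^ (s.card - 1) * ∑ j ∈ s, ρ j|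
            + |ρ a| * |∏ j ∈ s, (z + ρ j) - z ^ s.card| := by
          rw [← abs_mul, ← abs_mul]; exact abs_add_le _ _
      _ ≤ K * ((2 * K) ^ s.card * E) + K * η a * ((2 * K) ^ s.card * ∑ j ∈ s, η j) := by
          have := hη a
          gcongr
          exact hρη a
      _ ≤ (2 * K) ^ (s.card + 1) * (E + η a * ∑ j ∈ s, η j) := by
          have h1 : 0 ≤ K * (2 * K) ^ s.card * (E + η a * ∑ j ∈ s, η j) := by
            have := hη a
            positivity
          rw [pow_succ]
          linarith
      _ ≤ _ := by gcongr

end Expansion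

variable {r k : ℕ} {w : (Fin r → ℕ) → ℕ}

theorem prod_rpow_update {ι : Type*} [Fintype ι] [DecidableEq ι] {y : ι → ℝ} (hy : ∀ j, 0 < y j)
    (s : ι → ℝ) (i : ι) (a : ℝ) :
    ∏ j, y j ^ Function.update s i a j = (∏ j, y j ^ s j) * y i ^ (a - s i) := by
  rw [← Finset.mul_prod_erase _ _ (Finset.mem_univ i),
    ← Finset.mul_prod_erase _ (fun j => y j ^ s j) (Finset.mem_univ i), Function.update_self,
    show y i ^ a = y i ^ s i * y i ^ (a - s i) by
      rw [← Real.rpow_add (hy i)]; congr 1; ring]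
  have : ∀ j ∈ Finset.univ.erase i, y j ^ Function.update s i a j = y j ^ s j := fun j hj => by
    rw [Function.update_of_ne (Finset.ne_of_mem_erase hj)]
  rw [Finset.prod_congr rfl this]
  ring

theorem prod_div_rpow {x : ℝ} (hx : 0 < x) (d : Fin r → ℕ)
    (s : Fin r → ℝ) :
    ∏ j, (x / d j) ^ s j = x ^ (∑ j, s j) * ∏ j, (d j : ℝ) ^ (-s j) := by
  rw [Real.rpow_sum_of_pos hx, ← Finset.prod_mul_distrib]
  refine Finset.prod_congr rfl fun j _ => ?_
  rw [Real.div_rpow hx.le (Nat.cast_nonneg _), Real.rpow_neg (Nat.cast_nonneg _),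
    div_eq_mul_inv]

/-- The point with coordinate `a` at `i` and coordinates `1` elsewhere. -/
noncomputable def axisPoint (i : Fin r) (a : ℝ) : Fin r → ℝ := Function.update (fun _ => 1) i a

theorem sum_update {ι : Type*} [Fintype ι] [DecidableEq ι] (s : ι → ℝ) (i : ι) (a : ℝ) :
    ∑ j, Function.update s i a j = ∑ j, s j + (a - s i) := by
  rw [← Finset.add_sum_erase _ _ (Finset.mem_univ i),
    ← Finset.add_sum_erase _ s (Finset.mem_univ i), Function.update_self]
  have : ∀ j ∈ Finset.univ.erase i, Function.update s i a j = s j := fun j hj =>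
    Function.update_of_ne (Finset.ne_of_mem_erase hj) _ _
  rw [Finset.sum_congr rfl this]
  ring

theorem sum_axisPoint (i : Fin r) (a : ℝ) : ∑ j, axisPoint i a j = r - 1 + a := by
  rw [axisPoint, sum_update]
  simp
  ring

theorem axisPoint_pos (i : Fin r) {a : ℝ} (ha : 0 < a) (j : Fin r) : 0 < axisPoint i a j := by
  rw [axisPoint, Function.update_apply]
  split_ifs <;> linarith

theorem axisPoint_add_le (i : Fin r) {a : ℝ} (ha1 : a ≤ 1) (j l : Fin r)
    (hjl : j ≠ l) : 1 + a ≤ axisPoint i a j + axisPoint i a l := by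
  simp only [axisPoint, Function.update_apply]
  split_ifs with h1 h2 h2
  · exact absurd (h1.trans h2.symm) hjl
  all_goals linarith

theorem le_update_axisPoint (i j : Fin r) {β : ℝ} (hβ : β ≤ 1) (l : Fin r) :
    β ≤ Function.update (axisPoint i β) j β l := by
  simp only [axisPoint, Function.update_apply]
  split_ifs <;> linarith

/-- The expansion of `∏ j, T(x / d j)` with a remainder controlled by powers of `x / d j`. -/
theorem abs_prod_tauSum_sub_le (hk : 2 ≤ k) {θ C : ℝ} (hθ : 0 < θ)
    (hθk : θ ≤ 1 / (k : ℝ)) (hC : ∀ x : ℝ, 0 < x → |oneVarError k x| ≤ C * x ^ θ)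
    {y : Fin r → ℝ} (hy : ∀ j, 0 < y j) :
    |∏ j, tauSum k (y j) - zetaR k ^ r * ∏ j, y j ^ (1 : ℝ)
        - zetaR k ^ (r - 1) * zetaR (1 / (k : ℝ)) *
          ∑ i, ∏ j, y j ^ axisPoint i (1 / (k : ℝ)) j| ≤
      (2 * (3 + zetaR k)) ^ r * (∑ i, ∑ j, if i = j then 0 else
          ∏ l, y l ^ Function.update (axisPoint i ((1 + θ) / 2)) j ((1 + θ) / 2) l)
        + zetaR k ^ (r - 1) * C * ∑ i, ∏ j, y j ^ axisPoint i θ j := by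
  have hz := zetaR_natCast_pos (k := k) (by omega)
  have hk2 := one_div_natCast_le_one hk
  set z := zetaR k
  set Z := zetaR (1 / (k : ℝ))
  -- Two factors y^(β-1) in place of 1 lower the total degree r to r - 2 + 2β = r - 1 + θ. The bound
  -- with exponent β is available since β ≥ 1/2 ≥ 1/k.
  set β := (1 + θ) / 2 with hβ
  set K := 3 + z
  let ρ : Fin r → ℝ := fun j => (tauSum k (y j) - z * y j) / y j
  let η : Fin r → ℝ := fun j => y j ^ (β - 1)
  have hη : ∀ j, 0 ≤ η j := fun j => (Real.rpow_pos_of_pos (hy j) _).le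
  have hρa : ∀ j, ∀ a, 1 / (k : ℝ) ≤ a → a ≤ 1 → |ρ j| ≤ K * y j ^ (a - 1) :=
    fun j a ha ha1 => by
      rw [abs_div, abs_of_pos (hy j), Real.rpow_sub_one (hy j).ne', ← mul_div_assoc]
      exact div_le_div_of_nonneg_right (abs_tauSum_sub_le_rpow hk (hy j) ha ha1) (hy j).le
  have hρ : ∀ j, |ρ j| ≤ K := fun j => by
    simpa using hρa j 1 (by linarith) le_rfl
  have hρη : ∀ j, |ρ j| ≤ K * η j := fun j => hρa j β (by linarith) (by linarith)
  have hmain := abs_prod_add_sub_pow_sub_le (z := z) (K := K) (by linarith)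
    (by rw [abs_of_pos hz]; linarith) hρ hρη hη Finset.univ
  rw [Finset.card_univ, Fintype.card_fin] at hmain
  have hρE : ∀ j, ρ j = Z * y j ^ (1 / (k : ℝ) - 1) + oneVarError k (y j) / y j := fun j => by
    rw [oneVarError_eq, Real.rpow_sub_one (hy j).ne']
    simp only [ρ]
    field_simp
    ring
  have hE : |∑ j, oneVarError k (y j) / y j| ≤ C * ∑ j, y j ^ (θ - 1) := by
    rw [Finset.mul_sum]
    refine (Finset.abs_sum_le_sum_abs _ _).trans (Finset.sum_le_sum fun j _ => ?_)
    rw [abs_div, abs_of_pos (hy j), Real.rpow_sub_one (hy j).ne', ← mul_div_assoc]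
    exact div_le_div_of_nonneg_right (hC _ (hy j)) (hy j).le
  set Y := ∏ j, y j ^ (1 : ℝ) with hYdef
  have hY : 0 < Y := Finset.prod_pos fun j _ => Real.rpow_pos_of_pos (hy j) _
  have hT : ∏ j, tauSum k (y j) = Y * ∏ j, (z + ρ j) := by
    rw [hYdef, ← Finset.prod_mul_distrib]
    refine Finset.prod_congr rfl fun j _ => ?_
    have := (hy j).ne'
    rw [Real.rpow_one]
    simp only [ρ]
    field_simp
    ring
  have hax : ∀ a i, ∏ j, y j ^ axisPoint i a j = Y * y i ^ (a - 1) := fun a i =>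
    prod_rpow_update hy _ i a
  have hax2 : ∀ i j, (if i = j then 0 else
      ∏ l, y l ^ Function.update (axisPoint i β) j β l) =
      Y * if i = j then 0 else η i * η j := fun i j => by
    split_ifs with h
    · rw [mul_zero]
    · rw [prod_rpow_update hy, hax, axisPoint, Function.update_of_ne (Ne.symm h), mul_assoc]
  simp_rw [hax, hax2, ← Finset.mul_sum]
  have hsum : ∑ j, ρ j = Z * ∑ j, y j ^ (1 / (k : ℝ) - 1) +
      ∑ j, oneVarError k (y j) / y j := by
    simp_rw [hρE]
    rw [Finset.sum_add_distrib, Finset.mul_sum]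
  set P := ∏ j, (z + ρ j)
  have hsplit : ∏ j, tauSum k (y j) - z ^ r * Y -
      z ^ (r - 1) * Z * (Y * ∑ i, y i ^ (1 / (k : ℝ) - 1)) =
      Y * (P - z ^ r - z ^ (r - 1) * ∑ j, ρ j) +
        Y * (z ^ (r - 1) * ∑ j, oneVarError k (y j) / y j) := by
    rw [hT, hsum]
    ring
  rw [hsplit]
  refine (abs_add_le _ _).trans ?_
  rw [abs_mul, abs_mul, abs_mul, abs_of_pos hY, abs_of_pos (pow_pos hz (r - 1))]
  calc _ ≤ Y * ((2 * K) ^ r * ∑ i, ∑ j, if i = j then 0 else η i * η j) +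
        Y * (z ^ (r - 1) * (C * ∑ j, y j ^ (θ - 1))) := by gcongr
    _ = _ := by ring

/-- The value at `s` of the Dirichlet series of `corrector k w`. -/
noncomputable def correctorSeries (k : ℕ) (w : (Fin r → ℕ) → ℕ) (s : Fin r → ℝ) : ℝ :=
  ∑' d : Fin r → ℕ, corrector k w d * ∏ j, (d j : ℝ) ^ (-s j)

theorem exists_abs_sum_box_sub_le (hw : IsDivisorWeight k w) (hk : 2 ≤ k)
    {f : (Fin r → ℕ) → ℝ}
    (hf : ∀ n : Fin r → ℕ, (∀ j, n j ≠ 0) → f n = mulExt (fun _ ν => (w ν : ℝ)) n)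
    {θ C : ℝ} (hθ : 0 < θ) (hθk : θ ≤ 1 / (k : ℝ))
    (hC : ∀ x : ℝ, 0 < x → |oneVarError k x| ≤ C * x ^ θ) :
    ∃ C' : ℝ, ∀ x : ℝ, 0 < x →
      |∑ n ∈ box r x, f n - zetaR k ^ r * (x ^ r * correctorSeries k w fun _ => 1)
        - zetaR k ^ (r - 1) * zetaR (1 / (k : ℝ)) *
          ∑ i, x ^ ((r : ℝ) - 1 + 1 / (k : ℝ)) *
            correctorSeries k w (axisPoint i (1 / (k : ℝ)))| ≤
      x ^ ((r : ℝ) - 1 + θ) * C' := by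
  have hk1 : 1 ≤ k := by omega
  have hkpos : 0 < 1 / (k : ℝ) := by positivity
  have hk2 := one_div_natCast_le_one hk
  set β := (1 + θ) / 2 with hβ
  let Φ : (Fin r → ℝ) → (Fin r → ℕ) → ℝ := fun s d => corrector k w d * ∏ j, (d j : ℝ) ^ (-s j)
  have hΦ1 : Summable (Φ fun _ => 1) :=
    hw.summable_corrector hk1 one_pos (fun _ => one_pos) fun _ _ _ => le_rfl
  have hΦa : ∀ a, 0 < a → a ≤ 1 → ∀ i, Summable (Φ (axisPoint i a)) := fun a ha ha1 i =>
    hw.summable_corrector hk1 ha (axisPoint_pos i ha) (axisPoint_add_le i ha1)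
  -- All coordinates are at least β, so any two sum to at least 2β = 1 + θ; here θ > 0 is essential.
  have hΦb : ∀ i j, Summable (Φ (Function.update (axisPoint i β) j β)) := fun i j =>
    hw.summable_corrector hk1 hθ
      (fun l => lt_of_lt_of_le (by linarith) (le_update_axisPoint i j (by linarith) l))
      fun l m _ => by
        have h1 := le_update_axisPoint i j (β := β) (by linarith) l
        have h2 := le_update_axisPoint i j (β := β) (by linarith) m
        linarith
  set z := zetaR k
  set Z := zetaR (1 / (k : ℝ))
  let G : (Fin r → ℕ) → ℝ := fun d =>
    (2 * (3 + z)) ^ r * (∑ i, ∑ j, if i = j then 0 else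
        |Φ (Function.update (axisPoint i β) j β) d|)
      + z ^ (r - 1) * C * ∑ i, |Φ (axisPoint i θ) d|
  have hG : Summable G := by
    refine Summable.add (Summable.mul_left _ (summable_sum fun i _ => summable_sum fun j _ => ?_))
      (Summable.mul_left _ (summable_sum fun i _ => (hΦa θ hθ (by linarith) i).abs))
    split_ifs
    · exact summable_zero
    · exact (hΦb i j).abs
  refine ⟨∑' d, G d, fun x hx => ?_⟩
  -- The sum over the box extends to all d: T(x / d_j) = 0 when d_j > x, and h vanishes at tuples
  -- with a zero entry. No tails of the main series need separate treatment.
  have hS : HasSum (fun d : Fin r → ℕ => corrector k w d * ∏ j, tauSum k (x / d j))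
      (∑ n ∈ box r x, f n) := by
    rw [sum_box_eq hw hk1 hf]
    refine hasSum_sum_of_ne_finset_zero fun d hd => ?_
    by_cases hd0 : ∀ j, d j ≠ 0
    · have : ¬ ∀ j, d j ∈ Finset.Icc 1 ⌊x⌋₊ := fun h => hd (Fintype.mem_piFinset.mpr h)
      push Not at this
      obtain ⟨j, hj⟩ := this
      have hjx : x < d j := by
        rw [Finset.mem_Icc, not_and, not_le] at hj
        exact (Nat.floor_lt hx.le).mp (hj (Nat.one_le_iff_ne_zero.mpr (hd0 j)))
      rw [Finset.prod_eq_zero (Finset.mem_univ j), mul_zero]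
      exact tauSum_of_lt_one k ((div_lt_one (hx.trans hjx)).mpr hjx)
    · push Not at hd0
      obtain ⟨j, hj⟩ := hd0
      rw [corrector, mulExt_of_eq_zero _ hj, zero_mul]
  have h1 := (hΦ1.hasSum.mul_left (x ^ r)).mul_left (z ^ r)
  have h2 := (hasSum_sum (s := Finset.univ) fun i _ =>
    (hΦa _ hkpos (by linarith) i).hasSum.mul_left (x ^ ((r : ℝ) - 1 + 1 / (k : ℝ)))).mul_left
      (z ^ (r - 1) * Z)
  refine ((hS.sub h1).sub h2).norm_le_of_bounded
    (hG.hasSum.mul_left (x ^ ((r : ℝ) - 1 + θ))) fun d => ?_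
  by_cases hd0 : ∀ j, d j ≠ 0
  · have hy : ∀ j, 0 < x / (d j : ℝ) := fun j =>
      div_pos hx (Nat.cast_pos.mpr (Nat.pos_of_ne_zero (hd0 j)))
    have hmain := abs_prod_tauSum_sub_le hk hθ hθk hC hy
    simp_rw [← hβ, prod_div_rpow hx d, sum_axisPoint] at hmain
    have hsum2 : ∀ i j : Fin r, i ≠ j →
        ∑ l, Function.update (axisPoint i β) j β l = r - 1 + θ := fun i j hij => by
      rw [sum_update, sum_axisPoint, axisPoint, Function.update_of_ne hij.symm, hβ]
      ring
    have hite : ∀ i j : Fin r, (if i = j then 0 else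
        x ^ (∑ l, Function.update (axisPoint i β) j β l) *
          ∏ l, (d l : ℝ) ^ (-Function.update (axisPoint i β) j β l)) =
        x ^ ((r : ℝ) - 1 + θ) * if i = j then 0 else
          ∏ l, (d l : ℝ) ^ (-Function.update (axisPoint i β) j β l) := fun i j => by
      split_ifs with h
      · rw [mul_zero]
      · rw [hsum2 i j h]
    have hone : x ^ (∑ _j : Fin r, (1 : ℝ)) = x ^ r := by
      rw [Finset.sum_const, Finset.card_univ, Fintype.card_fin, nsmul_eq_mul, mul_one,
        Real.rpow_natCast]
    simp_rw [hite, ← Finset.mul_sum] at hmain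
    rw [hone] at hmain
    have hmul := mul_le_mul_of_nonneg_left hmain (abs_nonneg (corrector k w d))
    rw [← abs_mul] at hmul
    have habs : ∀ s : Fin r → ℝ,
        |Φ s d| = |corrector k w d| * ∏ j, (d j : ℝ) ^ (-s j) := fun s => by
      rw [abs_mul, abs_of_nonneg (Finset.prod_nonneg fun j _ =>
        Real.rpow_nonneg (Nat.cast_nonneg _) _)]
    have hite2 : ∀ i j : Fin r, (if i = j then 0 else
        |Φ (Function.update (axisPoint i β) j β) d|) = |corrector k w d| * if i = j then 0 else
          ∏ l, (d l : ℝ) ^ (-Function.update (axisPoint i β) j β l) := fun i j => by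
      split_ifs
      · rw [mul_zero]
      · exact habs _
    simp only [G, hite2]
    simp only [habs, ← Finset.mul_sum, Φ, z, Z, Real.norm_eq_abs]
    refine (le_of_eq_of_le ?_ hmul).trans_eq ?_
    · congr 1
      ring
    · ring
  · push Not at hd0
    obtain ⟨j, hj⟩ := hd0
    have h0 : corrector k w d = 0 := mulExt_of_eq_zero _ hj
    simp [G, Φ, h0]

end DivisorAverages

/-! ### Identification of the constants and the final asymptotics. -/

namespace DivisorAverages

variable {r k : ℕ} {w : (Fin r → ℕ) → ℕ}

theorem hasProd_zetaR {k : ℕ} (hk : 1 < k) :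
    HasProd (fun p : Nat.Primes => (1 - (p : ℝ) ^ (-(k : ℝ)))⁻¹) (zetaR k) := by
  let f : ℕ →*₀ ℝ :=
    { toFun := fun n => 1 / (n : ℝ) ^ k
      map_zero' := by simp; omega
      map_one' := by simp
      map_mul' := fun m n => by rw [Nat.cast_mul, mul_pow, one_div_mul_one_div] }
  have hf : Summable fun n => ‖f n‖ := (Real.summable_one_div_nat_pow.mpr hk).norm
  have h := EulerProduct.eulerProduct_completely_multiplicative_hasProd hf
  rw [zetaR_natCast hk]
  refine h.congr_fun fun p => ?_
  rw [Real.rpow_neg (Nat.cast_nonneg _), Real.rpow_natCast, ← one_div (_ ^ k)]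
  rfl

/-- At (1, …, 1) the second factor carries r extra factors 1 - p^(-k); over all primes these account
for ζ(k)^r. -/
theorem mainFactor_eq (hk : 1 ≤ k) {p : ℕ} (hp : p.Prime) :
    mainFactor w p =
      secondFactor k w (fun _ => 1) p * ((1 - (p : ℝ) ^ (-(k : ℝ)))⁻¹) ^ r := by
  have hne : 1 - (p : ℝ) ^ (-(k : ℝ)) ≠ 0 :=
    (sub_pos.mpr (rpow_neg_lt_one_of_prime hp (Nat.cast_pos.mpr hk))).ne'
  have h1 : ∀ ν : Fin r → ℕ, localTerm w (fun _ => 1) p ν = (w ν : ℝ) / (p : ℝ) ^ (∑ j, ν j) :=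
    fun ν => by
      rw [localTerm, ← Real.rpow_natCast]
      simp
  rw [secondFactor, mainFactor]
  simp_rw [h1, mul_one, Finset.prod_const, Finset.card_univ, Fintype.card_fin,
    Real.rpow_neg_one, ← one_div]
  rw [mul_pow, one_div_pow]
  field_simp

theorem IsDivisorWeight.hasProd_mainFactor (hw : IsDivisorWeight k w) (hk : 2 ≤ k) :
    HasProd (fun p : Nat.Primes => mainFactor w p)
      (correctorSeries k w (fun _ => 1) * zetaR k ^ r) := by
  have h1 := hw.hasProd_secondFactor (by omega) one_pos (s := fun _ => 1) (fun _ => one_pos)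
    fun _ _ _ => le_rfl
  have h2 := hasProd_prod (s := (Finset.univ : Finset (Fin r)))
    fun _ _ => hasProd_zetaR (k := k) (by omega)
  simp_rw [Finset.prod_const, Finset.card_univ, Fintype.card_fin] at h2
  exact (h1.mul h2).congr_fun fun p => mainFactor_eq (by omega) p.2

theorem IsDivisorWeight.hasProd_axisPoint (hw : IsDivisorWeight k w) (hk : 2 ≤ k) (i : Fin r) :
    HasProd (fun p : Nat.Primes => secondFactor k w (axisPoint i (1 / (k : ℝ))) p)
      (correctorSeries k w (axisPoint i (1 / (k : ℝ)))) := by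
  have h0 : 0 < 1 / (k : ℝ) := by positivity
  have h1 : 1 / (k : ℝ) ≤ 1 := by linarith [one_div_natCast_le_one hk]
  exact hw.hasProd_secondFactor (by omega) h0 (axisPoint_pos i h0) (axisPoint_add_le i h1)

theorem secondPoint_eq_axisPoint (hr : 0 < r) :
    secondPoint r k = axisPoint ⟨r - 1, by omega⟩ (1 / (k : ℝ)) := by
  funext j
  rw [secondPoint, axisPoint, Function.update_apply]
  have : (j : ℕ) + 1 = r ↔ j = ⟨r - 1, by omega⟩ := by
    rw [Fin.ext_iff]
    simp only
    omega
  simp_rw [this]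

theorem IsDivisorWeight.hasProd_secondPoint (hw : IsDivisorWeight k w) (hk : 2 ≤ k) (i : Fin r) :
    HasProd (fun p : Nat.Primes => secondFactor k w (secondPoint r k) p)
      (correctorSeries k w (axisPoint i (1 / (k : ℝ)))) := by
  have hr : 0 < r := i.pos
  refine (hw.hasProd_axisPoint hk i).congr_fun fun p => ?_
  rw [secondPoint_eq_axisPoint hr,
    ← hw.secondFactor_comp_perm (Equiv.swap ⟨r - 1, by omega⟩ i) (axisPoint i _)]
  congr 1
  funext j
  simp only [axisPoint, Function.update_apply, Function.comp_apply]
  congr 1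
  rw [Equiv.swap_apply_eq_iff, Equiv.swap_apply_right]

theorem IsDivisorWeight.constsConverge (hw : IsDivisorWeight k w) (hk : 2 ≤ k) (hr : 0 < r) :
    ConstsConverge k w := by
  have hpos : ∀ j, 0 < secondPoint r k j := by
    rw [secondPoint_eq_axisPoint hr]
    exact axisPoint_pos _ (by positivity)
  refine ⟨fun p => ?_, (hw.hasProd_mainFactor hk).multipliable,
    fun p => hw.summable_localTerm hpos p.2,
    (hw.hasProd_secondPoint hk ⟨0, hr⟩).multipliable⟩
  refine (hw.summable_localTerm (s := fun _ => 1) (fun _ => one_pos) p.2).congr fun ν => ?_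
  rw [localTerm, ← Real.rpow_natCast]
  simp

theorem IsDivisorWeight.mainConst_eq (hw : IsDivisorWeight k w) (hk : 2 ≤ k) :
    mainConst w = zetaR k ^ r * correctorSeries k w fun _ => 1 := by
  rw [mainConst, (hw.hasProd_mainFactor hk).tprod_eq, mul_comm]

theorem IsDivisorWeight.secondConst_eq (hw : IsDivisorWeight k w) (hk : 2 ≤ k) :
    secondConst k w = zetaR k ^ (r - 1) * zetaR (1 / (k : ℝ)) *
      ∑ i, correctorSeries k w (axisPoint i (1 / (k : ℝ))) := by
  have h : ∀ i ∈ (Finset.univ : Finset (Fin r)),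
      correctorSeries k w (axisPoint i (1 / (k : ℝ))) =
        ∏' p : Nat.Primes, secondFactor k w (secondPoint r k) p :=
    fun i _ => (hw.hasProd_secondPoint hk i).tprod_eq.symm
  rw [secondConst, Finset.sum_congr rfl h, Finset.sum_const, Finset.card_univ, Fintype.card_fin,
    nsmul_eq_mul]
  ring

theorem theta_nonneg (hk : 2 ≤ k) : 0 ≤ theta k :=
  nonneg_of_mem_admissibleExponents hk (isLeast_theta hk).1

/-- The asymptotic formula for sums of multiplicative functions with divisor weights. -/
theorem IsDivisorWeight.sum_box_isBigO (hw : IsDivisorWeight k w) (hk : 2 ≤ k)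
    {f : (Fin r → ℕ) → ℝ}
    (hf : ∀ n : Fin r → ℕ, (∀ j, n j ≠ 0) → f n = mulExt (fun _ ν => (w ν : ℝ)) n)
    {ε : ℝ} (hε : 0 < ε) :
    (fun x : ℝ => ∑ n ∈ box r x, f n
        - (mainConst w * x ^ r + secondConst k w * x ^ ((r : ℝ) - 1 + 1 / (k : ℝ))))
      =O[atTop] fun x : ℝ => x ^ ((r : ℝ) - 1 + theta k + ε) := by
  have hθ0 := theta_nonneg hk
  -- Positivity, which the summation over d needs, comes from ε even if θ_k = 0. The cap 1/k makes
  -- the error bound valid for all x > 0.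
  set θ := min (theta k + ε) (1 / (k : ℝ))
  have hθ : 0 < θ := lt_min (by linarith) (by positivity)
  have hE : oneVarError k =O[atTop] fun x : ℝ => x ^ θ := by
    rcases min_choice (theta k + ε) (1 / (k : ℝ)) with h | h
    · simpa only [θ, h] using (isLeast_theta hk).1 ε hε
    · simpa only [θ, h] using oneVarError_isBigO hk
  obtain ⟨C, -, hC⟩ := exists_abs_oneVarError_le hk (min_le_right _ _) hE
  obtain ⟨C', hC'⟩ := exists_abs_sum_box_sub_le hw hk hf hθ (min_le_right _ _) hC
  refine IsBigO.trans (g := fun x : ℝ => x ^ ((r : ℝ) - 1 + θ)) (IsBigO.of_bound C' ?_)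
    (rpow_isBigO_rpow (by linarith [min_le_left (theta k + ε) (1 / (k : ℝ))]))
  filter_upwards [eventually_gt_atTop 0] with x hx
  rw [Real.norm_of_nonneg (Real.rpow_nonneg hx.le _), mul_comm C']
  refine le_of_eq_of_le ?_ (hC' x hx)
  rw [Real.norm_eq_abs, hw.mainConst_eq hk, hw.secondConst_eq hk, ← Finset.mul_sum]
  congr 1
  ring

end DivisorAverages

theorem mainTheorem1 (k r : ℕ) (hk : 2 ≤ k) (hr : 2 ≤ r) :
    IsLeast (DivisorAverages.admissibleExponents k) (DivisorAverages.theta k) ∧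
    DivisorAverages.ConstsConverge k (DivisorAverages.prodWeight r k) ∧
    DivisorAverages.ConstsConverge k (DivisorAverages.lcmWeight r k) ∧
    ∀ ε : ℝ, 0 < ε →
      ((fun x : ℝ => DivisorAverages.prodSum r k x
          - (DivisorAverages.constA r k * x ^ r
            + DivisorAverages.constB r k * x ^ ((r : ℝ) - 1 + 1 / (k : ℝ))))
        =O[atTop] fun x : ℝ => x ^ ((r : ℝ) - 1 + DivisorAverages.theta k + ε)) ∧
      ((fun x : ℝ => DivisorAverages.lcmSum r k x
          - (DivisorAverages.constC r k * x ^ r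
            + DivisorAverages.constD r k * x ^ ((r : ℝ) - 1 + 1 / (k : ℝ))))
        =O[atTop] fun x : ℝ => x ^ ((r : ℝ) - 1 + DivisorAverages.theta k + ε)) := by
  have hA := DivisorAverages.isDivisorWeight_prodWeight r k
  have hC := DivisorAverages.isDivisorWeight_lcmWeight r k
  exact ⟨DivisorAverages.isLeast_theta hk, hA.constsConverge hk (by omega),
    hC.constsConverge hk (by omega), fun ε hε =>
    ⟨hA.sum_box_isBigO hk (fun n hn => DivisorAverages.tau_prod_eq_mulExt (by omega) hn) hε,
      hC.sum_box_isBigO hk (fun n hn => DivisorAverages.tau_lcm_eq_mulExt (by omega) hn) hε⟩⟩
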